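/- Let $k$ be a field and let $(H,\alpha)$ be a monoidal Hom-Hopf algebra over $k$ with bijective antipode $S$. That is, $H$ is a vector space with a linear automorphism $\alpha$, multiplication, unit $1$, comultiplication $\Delta(h)=h_1\otimes h_2$, counit $\varepsilon$ and a linear map $S$ such that, for all $a,b,c,h\in H$, $$\alpha(a)(bc)=(ab)\alpha(c),\quad \alpha(ab)=\alpha(a)\alpha(b),\quad a1=1a=\alpha(a),\quad \alpha(1)=1,$$ $$\alpha^{-1}(h_1)\otimes\Delta(h_2)=\Delta(h_1)\otimes\alpha^{-1}(h_2),\quad \Delta(\alpha(h))=\alpha(h_1)\otimes\alpha(h_2),\quad h_1\varepsilon(h_2)=\varepsilon(h_1)h_2=\alpha^{-1}(h),\quad \varepsilon(\alpha(h))=\varepsilon(h),$$ $\Delta$ and $\varepsilon$ preserve products and units, $S\alpha=\alpha S$, and $S(h_1)h_2=\varepsilon(h)1=h_1S(h_2)$. Let $\mathrm{Aut}_{mHH}(H)$ be the group of linear bijections of $H$ that commute with $\alpha$ and preserve the multiplication, unit, comultiplication and counit. Let $G=\mathrm{Aut}_{mHH}(H)\times\mathrm{Aut}_{mHH}(H)$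 be the group with product $(A,B)*(C,D)=(AC,\,DC^{-1}BC)$. For $(A,B)\in G$, an $(A,B)$-Yetter–Drinfeld Hom-module is a vector space $M$ with a linear automorphism $\mu$, an action $h\cdot m$ of $H$ and a coaction $\rho(m)=m_{(0)}\otimes m_{(1)}\in M\otimes H$ such that $$\alpha(a)\cdot(b\cdot m)=(ab)\cdot\mu(m),\quad \mu(a\cdot m)=\alpha(a)\cdot\mu(m),\quad 1\cdot m=\mu(m),$$ $$\mu^{-1}(m_{(0)})\otimes\Delta(m_{(1)})=m_{(0)(0)}\otimes m_{(0)(1)}\otimes\alpha^{-1}(m_{(1)}),\quad \rho(\mu(m))=\mu(m_{(0)})\otimes\alpha(m_{(1)}),\quad m_{(0)}\varepsilon(m_{(1)})=\mu^{-1}(m),$$ $$\rho(h\cdot m)=\alpha(h_{21})\cdot m_{(0)}\otimes\bigl(B(h_{22})\alpha^{-1}(m_{(1)})\bigr)A(S^{-1}(h_1)).$$ Morphisms are the $H$-linear and $H$-colinear maps that commute with the automorphisms. Let $\mathcal{MHYD}(H)$ be the disjoint union over $(A,B)\in G$ of the resulting categories ${}_H\mathcal{MHYD}^H(A,B)$.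 A braided $T$-category over a group $G$ is a monoidal category $\mathcal C$ with the following additional structure. It is the disjoint union of subcategories $\mathcal C_g$ ($g\in G$) with $\mathcal C_g\otimes\mathcal C_{g'}\subseteq\mathcal C_{gg'}$. There is a group homomorphism $\varphi$ from $G$ to the group of invertible strict tensor functors $\mathcal C\to\mathcal C$ with $\varphi_g(\mathcal C_{g'})\subseteq\mathcal C_{gg'g^{-1}}$; write ${}^{U}V=\varphi_g(V)$ and ${}^{U}f=\varphi_g(f)$ for $U\in\mathcal C_g$. There are isomorphisms $c_{U,V}:U\otimes V\to{}^{U}V\otimes U$ such that $$({}^{U}g\otimes f)\circ c_{U,V}=c_{U',V'}\circ(f\otimes g)\quad\text{for } f:U\to U',\ g:V\to V',$$ $$c_{U\otimes V,W}=a_{{}^{U\otimes V}W,U,V}\circ(c_{U,{}^{V}W}\otimes\mathrm{id}_V)\circ a^{-1}_{U,{}^{V}W,V}\circ(\mathrm{id}_U\otimes c_{V,W})\circ a_{U,V,W},$$ $$c_{U,V\otimes W}=a^{-1}_{{}^{U}V,{}^{U}W,U}\circ(\mathrm{id}_{{}^{U}V}\otimes c_{U,W})\circ a_{{}^{U}V,U,W}\circ(c_{U,V}\otimes\mathrm{id}_W)\circ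 a^{-1}_{U,V,W},$$ $$\varphi_g(c_{U,V})=c_{\varphi_g(U),\varphi_g(V)},$$ where $a$ is the associativity constraint. Theorem. $\mathcal{MHYD}(H)$ is a braided $T$-category over $G$ with the structure given below. In particular, all the objects below are Yetter–Drinfeld Hom-modules for the indices stated, and all the maps below are morphisms. Let $(M,\mu)$ be an object of ${}_H\mathcal{MHYD}^H(A,B)$ and $(N,\nu)$ one of ${}_H\mathcal{MHYD}^H(C,D)$. * The tensor product of $M$ and $N$ is $(M\otimes N,\mu\otimes\nu)\in{}_H\mathcal{MHYD}^H((A,B)*(C,D))$, with $$h\cdot(m\otimes n)=C(h_1)\cdot m\otimes C^{-1}BC(h_2)\cdot n,\qquad m\otimes n\mapsto(m_{(0)}\otimes n_{(0)})\otimes n_{(1)}m_{(1)};$$ the tensor product of morphisms is that of linear maps. * The unit is $(k,\mathrm{id})\in{}_H\mathcal{MHYD}^H(\mathrm{id},\mathrm{id})$, with $h\cdot x=\varepsilon(h)x$ and $x\mapsto x\otimes1$. The constraints are $(m\otimes n)\otimes p\mapsto\mu(m)\otimes(n\otimes\varsigma^{-1}(p))$ for objects $(M,\mu),(N,\nu),(P,\varsigma)$,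 together with $x\otimes m\mapsto x\mu(m)$ and $m\otimes x\mapsto x\mu(m)$. * The conjugation functor $\varphi_{(A,B)}$ sends $(N,\nu)$ to ${}^{(A,B)}N\in{}_H\mathcal{MHYD}^H((A,B)*(C,D)*(A,B)^{-1})$. This is $N$ as a vector space, with the same automorphism $\nu$ and $$h\rhd n=C^{-1}BCA^{-1}(h)\cdot n,\qquad n\mapsto n_{(0)}\otimes AB^{-1}(n_{(1)});$$ $\varphi_{(A,B)}$ is the identity on morphisms. * The braiding is $c_{M,N}:M\otimes N\to{}^{(A,B)}N\otimes M$, $c_{M,N}(m\otimes n)=\nu(n_{(0)})\otimes B^{-1}(n_{(1)})\cdot\mu^{-1}(m)$. -/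

import Mathlib

open CategoryTheory
open scoped TensorProduct MonoidalCategory

/-! ### Crossed categories and braided T-categories -/

/-- A strict tensor endofunctor: it preserves the unit, the tensor product of objects and of
morphisms, and the three constraints, all on the nose. The `eqToHom`s only identify objects that
are equal. -/
structure IsStrictTensor {C : Type*} [Category C] [MonoidalCategoryStruct C]
    (F : C ⥤ C) : Prop where
  obj_unit : F.obj (𝟙_ C) = 𝟙_ C
  obj_tensor : ∀ X Y : C, F.obj (X ⊗ Y) = F.obj X ⊗ F.obj Y
  map_tensor : ∀ {X X' Y Y' : C} (f : X ⟶ X') (g : Y ⟶ Y'),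
    F.map (f ⊗ₘ g) =
      eqToHom (obj_tensor X Y) ≫ (F.map f ⊗ₘ F.map g) ≫ eqToHom (obj_tensor X' Y').symm
  map_associator : ∀ X Y Z : C,
    F.map (α_ X Y Z).hom =
      eqToHom (by rw [obj_tensor, obj_tensor]) ≫ (α_ (F.obj X) (F.obj Y) (F.obj Z)).hom ≫
        eqToHom (by rw [obj_tensor, obj_tensor])
  map_leftUnitor : ∀ X : C,
    F.map (λ_ X).hom = eqToHom (by rw [obj_tensor, obj_unit]) ≫ (λ_ (F.obj X)).hom
  map_rightUnitor : ∀ X : C,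
    F.map (ρ_ X).hom = eqToHom (by rw [obj_tensor, obj_unit]) ≫ (ρ_ (F.obj X)).hom

/-- `C`, with its given tensor product, unit and constraints, is a crossed category over `G`, where
`deg X` is the index of the component that contains `X` and `conj g` is the conjugation functor
of `g`. -/
structure IsCrossedCategory {G C : Type*} [Group G] [Category C] [S : MonoidalCategoryStruct C]
    (deg : C → G) (conj : G → C ⥤ C) : Prop where
  /-- The tensor product, unit and constraints form a monoidal category. -/
  monoidal : ∃ m : MonoidalCategory C, m.toMonoidalCategoryStruct = S
  /-- `C` is the disjoint union of its components: there are no morphisms between different ones. -/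
  deg_hom : ∀ {X Y : C}, (X ⟶ Y) → deg X = deg Y
  deg_tensor : ∀ X Y : C, deg (X ⊗ Y) = deg X * deg Y
  /-- Conjugation is a group homomorphism from `G` to the invertible strict tensor functors
  (invertibility follows from `conj_one` and `conj_mul`). -/
  conj_one : conj 1 = 𝟭 C
  conj_mul : ∀ g h : G, conj (g * h) = conj h ⋙ conj g
  conj_strict : ∀ g : G, IsStrictTensor (conj g)
  deg_conj : ∀ (g : G) (X : C), deg ((conj g).obj X) = g * deg X * g⁻¹

theorem IsCrossedCategory.conj_tensor_obj {G C : Type*} [Group G] [Category C]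
    [MonoidalCategoryStruct C] {deg : C → G} {conj : G → C ⥤ C}
    (h : IsCrossedCategory deg conj) (U V W : C) :
    (conj (deg (U ⊗ V))).obj W = (conj (deg U)).obj ((conj (deg V)).obj W) := by
  rw [h.deg_tensor, h.conj_mul]; rfl

theorem IsCrossedCategory.conj_conj_obj {G C : Type*} [Group G] [Category C]
    [MonoidalCategoryStruct C] {deg : C → G} {conj : G → C ⥤ C}
    (h : IsCrossedCategory deg conj) (g : G) (U V : C) :
    (conj g).obj ((conj (deg U)).obj V) =
      (conj (deg ((conj g).obj U))).obj ((conj g).obj V) := by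
  have e : g * deg U = (g * deg U * g⁻¹) * g := by group
  rw [h.deg_conj, ← Functor.comp_obj, ← Functor.comp_obj, ← h.conj_mul, ← h.conj_mul, ← e]

/-- A crossed category over `G` together with a braiding `c U V : U ⊗ V ⟶ ᵁV ⊗ U`, where
`ᵁV = conj (deg U) V`, is a braided T-category over `G`. -/
structure IsBraidedTCategory {G C : Type*} [Group G] [Category C] [MonoidalCategoryStruct C]
    (deg : C → G) (conj : G → C ⥤ C)
    (c : ∀ U V : C, U ⊗ V ⟶ (conj (deg U)).obj V ⊗ U) : Prop where
  crossed : IsCrossedCategory deg conj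
  isIso : ∀ U V : C, IsIso (c U V)
  naturality : ∀ {U U' V V' : C} (f : U ⟶ U') (g : V ⟶ V'),
    (f ⊗ₘ g) ≫ c U' V' =
      c U V ≫ (((conj (deg U)).map g ≫ eqToHom (by rw [crossed.deg_hom f])) ⊗ₘ f)
  /-- `c` for a tensor product in the first variable. -/
  tensor_left : ∀ U V W : C,
    c (U ⊗ V) W =
      (α_ U V W).hom ≫ (𝟙 U ⊗ₘ c V W) ≫ (α_ U ((conj (deg V)).obj W) V).inv ≫
        (c U ((conj (deg V)).obj W) ⊗ₘ 𝟙 V) ≫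
        (α_ ((conj (deg U)).obj ((conj (deg V)).obj W)) U V).hom ≫
        eqToHom (by rw [crossed.conj_tensor_obj U V W])
  /-- `c` for a tensor product in the second variable. -/
  tensor_right : ∀ U V W : C,
    c U (V ⊗ W) =
      (α_ U V W).inv ≫ (c U V ⊗ₘ 𝟙 W) ≫ (α_ ((conj (deg U)).obj V) U W).hom ≫
        (𝟙 ((conj (deg U)).obj V) ⊗ₘ c U W) ≫
        (α_ ((conj (deg U)).obj V) ((conj (deg U)).obj W) U).inv ≫
        eqToHom (by rw [(crossed.conj_strict (deg U)).obj_tensor V W])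
  /-- Conjugation preserves the braiding. -/
  conj_braiding : ∀ (g : G) (U V : C),
    (conj g).map (c U V) =
      eqToHom ((crossed.conj_strict g).obj_tensor U V) ≫
        c ((conj g).obj U) ((conj g).obj V) ≫
        eqToHom (by rw [(crossed.conj_strict g).obj_tensor, crossed.conj_conj_obj g U V])

/-! ### Monoidal Hom-Hopf algebras and their automorphisms -/

universe u

/-- A monoidal Hom-Hopf algebra structure on the `k`-vector space `H`, written with its
multiplication `m`, unit `one`, comultiplication `Δ`, counit `ε` and antipode `S`. -/
structure MonoidalHomHopfAlgebra (k H : Type u) [Field k] [AddCommGroup H] [Module k H] where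
  α : H ≃ₗ[k] H
  m : H →ₗ[k] H →ₗ[k] H
  one : H
  Δ : H →ₗ[k] H ⊗[k] H
  ε : H →ₗ[k] k
  S : H →ₗ[k] H
  /-- `α(a)(bc) = (ab)α(c)` -/
  hom_assoc : ∀ a b c : H, m (α a) (m b c) = m (m a b) (α c)
  α_mul : ∀ a b : H, α (m a b) = m (α a) (α b)
  mul_one : ∀ a : H, m a one = α a
  one_mul : ∀ a : H, m one a = α a
  α_one : α one = one
  /-- `α⁻¹(c₁) ⊗ Δ(c₂) = Δ(c₁) ⊗ α⁻¹(c₂)` -/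
  hom_coassoc : ∀ c : H,
    TensorProduct.map α.symm.toLinearMap Δ (Δ c) =
      TensorProduct.assoc k H H H (TensorProduct.map Δ α.symm.toLinearMap (Δ c))
  comul_α : ∀ c : H, Δ (α c) = TensorProduct.map α.toLinearMap α.toLinearMap (Δ c)
  /-- `c₁ε(c₂) = α⁻¹(c)` -/
  counit_right : ∀ c : H, TensorProduct.rid k H (TensorProduct.map LinearMap.id ε (Δ c)) = α.symm c
  /-- `ε(c₁)c₂ = α⁻¹(c)` -/
  counit_left : ∀ c : H, TensorProduct.lid k H (TensorProduct.map ε LinearMap.id (Δ c)) = α.symm c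
  counit_α : ∀ c : H, ε (α c) = ε c
  /-- `Δ(ab) = a₁b₁ ⊗ a₂b₂` -/
  comul_mul : ∀ a b : H, Δ (m a b) = TensorProduct.map₂ m m (Δ a) (Δ b)
  comul_one : Δ one = one ⊗ₜ[k] one
  counit_mul : ∀ a b : H, ε (m a b) = ε a * ε b
  counit_one : ε one = 1
  S_α : ∀ a : H, S (α a) = α (S a)
  /-- `S(h₁)h₂ = ε(h)1` -/
  antipode_left : ∀ h : H, TensorProduct.lift (m ∘ₗ S) (Δ h) = ε h • one
  /-- `h₁S(h₂) = ε(h)1` -/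
  antipode_right : ∀ h : H, TensorProduct.lift (m.compl₂ S) (Δ h) = ε h • one

/-- A monoidal Hom-Hopf algebra with bijective antipode. -/
structure MonoidalHomHopfAlgebraBij (k H : Type u) [Field k] [AddCommGroup H] [Module k H]
    extends MonoidalHomHopfAlgebra k H where
  S_bijective : Function.Bijective S

/-- The group of automorphisms of a monoidal Hom-Hopf algebra: the bijective maps that are
monoidal Hom-algebra and monoidal Hom-coalgebra maps. The product is composition. -/
def AutMHH {k H : Type u} [Field k] [AddCommGroup H] [Module k H]
    (𝓗 : MonoidalHomHopfAlgebra k H) : Subgroup (H ≃ₗ[k] H) where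
  carrier := {A | (∀ a, A (𝓗.α a) = 𝓗.α (A a)) ∧ (∀ a b, A (𝓗.m a b) = 𝓗.m (A a) (A b)) ∧
    A 𝓗.one = 𝓗.one ∧
    (∀ a, 𝓗.Δ (A a) = TensorProduct.map A.toLinearMap A.toLinearMap (𝓗.Δ a)) ∧
    (∀ a, 𝓗.ε (A a) = 𝓗.ε a)}
  mul_mem' := by
    rintro A B ⟨a1, a2, a3, a4, a5⟩ ⟨b1, b2, b3, b4, b5⟩
    refine ⟨by simp [a1, b1], by simp [a2, b2], by simp [a3, b3], fun a => ?_, by simp [a5, b5]⟩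
    rw [LinearEquiv.mul_apply, a4, b4, ← LinearMap.comp_apply, ← TensorProduct.map_comp]
    rfl
  one_mem' := by
    refine ⟨by simp, by simp, by simp, fun a => ?_, by simp⟩
    simp
  inv_mem' := by
    rintro A ⟨a1, a2, a3, a4, a5⟩
    have e : ∀ x, A (A⁻¹ x) = x := fun x => A.apply_symm_apply x
    have e' : A⁻¹.toLinearMap ∘ₗ A.toLinearMap = LinearMap.id :=
      LinearMap.ext fun x => A.symm_apply_apply x
    refine ⟨fun a => A.injective ?_, fun a b => A.injective ?_, A.injective ?_, fun a => ?_,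
      fun a => ?_⟩
    · simp only [e, a1]
    · simp only [e, a2]
    · simp only [e, a3]
    · have h := a4 (A⁻¹ a)
      rw [e] at h
      rw [h, ← LinearMap.comp_apply, ← TensorProduct.map_comp, e']
      simp
    · rw [← a5 (A⁻¹ a), e]

/-- Pairs of elements of a group `Γ`, to be equipped with a twisted product. -/
@[ext]
structure TwistedPair (Γ : Type*) where
  fst : Γ
  snd : Γ

/-- The product `(A, B) * (C, D) = (AC, DC⁻¹BC)`. -/
instance {Γ : Type*} [Group Γ] : Group (TwistedPair Γ) where
  mul p q := ⟨p.fst * q.fst, q.snd * q.fst⁻¹ * p.snd * q.fst⟩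
  one := ⟨1, 1⟩
  inv p := ⟨p.fst⁻¹, p.fst * p.snd⁻¹ * p.fst⁻¹⟩
  mul_assoc p q r := by
    ext
    · exact mul_assoc _ _ _
    · change r.snd * r.fst⁻¹ * (q.snd * q.fst⁻¹ * p.snd * q.fst) * r.fst =
        (r.snd * r.fst⁻¹ * q.snd * r.fst) * (q.fst * r.fst)⁻¹ * p.snd * (q.fst * r.fst)
      group
  one_mul p := by
    ext
    · exact one_mul _
    · change p.snd * p.fst⁻¹ * 1 * p.fst = p.snd
      group
  mul_one p := by
    ext
    · exact mul_one _
    · change 1 * 1⁻¹ * p.snd * 1 = p.snd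
      group
  inv_mul_cancel p := by
    ext
    · exact inv_mul_cancel _
    · change p.snd * p.fst⁻¹ * (p.fst * p.snd⁻¹ * p.fst⁻¹) * p.fst = 1
      group

/-! ### Twisted Yetter-Drinfeld Hom-modules -/

section YetterDrinfeld

variable {k H : Type u} [Field k] [AddCommGroup H] [Module k H]

/-- The underlying data of a twisted Yetter-Drinfeld Hom-module, without axioms: the index
`deg = (A, B)` of its component, a vector space `V`, an automorphism `μ` of `V`,
an action `h · v = act h v` and a coaction `ρ`. -/
structure PreYD (𝓗 : MonoidalHomHopfAlgebraBij k H) where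
  deg : TwistedPair (AutMHH 𝓗.toMonoidalHomHopfAlgebra)
  V : Type u
  [addCommGroup : AddCommGroup V]
  [module : Module k V]
  μ : V ≃ₗ[k] V
  act : H →ₗ[k] V →ₗ[k] V
  ρ : V →ₗ[k] V ⊗[k] H

attribute [instance] PreYD.addCommGroup PreYD.module

namespace MonoidalHomHopfAlgebraBij

variable (𝓗 : MonoidalHomHopfAlgebraBij k H)

/-- The inverse of the antipode. -/
noncomputable def Sinv : H →ₗ[k] H :=
  (LinearEquiv.ofBijective 𝓗.S 𝓗.S_bijective).symm.toLinearMap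

end MonoidalHomHopfAlgebraBij

namespace PreYD

variable {𝓗 : MonoidalHomHopfAlgebraBij k H}

/-- The linear map `x ⊗ z ↦ (w ↦ (B(z)α⁻¹(w))A(S⁻¹(x)))`. -/
noncomputable def twist (A B : H →ₗ[k] H) : H ⊗[k] H →ₗ[k] (H →ₗ[k] H) :=
  TensorProduct.lift ((LinearMap.llcomp k H H H).compl₁₂ (𝓗.m.flip ∘ₗ A ∘ₗ 𝓗.Sinv)
    ((LinearMap.lcomp k H 𝓗.α.symm.toLinearMap) ∘ₗ 𝓗.m ∘ₗ B))

/-- The linear map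
`x ⊗ (y ⊗ z) ↦ (v ⊗ w ↦ α(y) · v ⊗ (B(z)α⁻¹(w))A(S⁻¹(x)))`, where `(A, B)` is the index of `M`. -/
noncomputable def compat (M : PreYD 𝓗) :
    H ⊗[k] (H ⊗[k] H) →ₗ[k] (M.V ⊗[k] H →ₗ[k] M.V ⊗[k] H) :=
  TensorProduct.homTensorHomMap (RingHom.id k) M.V H M.V H ∘ₗ
    TensorProduct.map (M.act ∘ₗ 𝓗.α.toLinearMap)
      (twist (𝓗 := 𝓗) M.deg.fst.1.toLinearMap M.deg.snd.1.toLinearMap) ∘ₗ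
    (TensorProduct.leftComm k H H H).toLinearMap

theorem compat_tmul (M : PreYD 𝓗) (x y z w : H) (v : M.V) :
    M.compat (x ⊗ₜ (y ⊗ₜ z)) (v ⊗ₜ w) =
      M.act (𝓗.α y) v ⊗ₜ[k]
        𝓗.m (𝓗.m (M.deg.snd.1 z) (𝓗.α.symm w)) (M.deg.fst.1 (𝓗.Sinv x)) := rfl

/-- `M` is a left-right `(A, B)`-Yetter-Drinfeld Hom-module, where `(A, B)` is its index. -/
structure IsYD (M : PreYD 𝓗) : Prop where
  /-- `α(a) · (b · v) = (ab) · μ(v)` -/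
  act_act : ∀ (a b : H) (v : M.V), M.act (𝓗.α a) (M.act b v) = M.act (𝓗.m a b) (M.μ v)
  μ_act : ∀ (a : H) (v : M.V), M.μ (M.act a v) = M.act (𝓗.α a) (M.μ v)
  one_act : ∀ v : M.V, M.act 𝓗.one v = M.μ v
  /-- `μ⁻¹(v₀) ⊗ Δ(v₁) = v₀₀ ⊗ (v₀₁ ⊗ α⁻¹(v₁))` -/
  coassoc : ∀ v : M.V,
    TensorProduct.map M.μ.symm.toLinearMap 𝓗.Δ (M.ρ v) =
      TensorProduct.assoc k M.V H H (TensorProduct.map M.ρ 𝓗.α.symm.toLinearMap (M.ρ v))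
  ρ_μ : ∀ v : M.V, M.ρ (M.μ v) = TensorProduct.map M.μ.toLinearMap 𝓗.α.toLinearMap (M.ρ v)
  /-- `v₀ε(v₁) = μ⁻¹(v)` -/
  counit : ∀ v : M.V,
    TensorProduct.rid k M.V (TensorProduct.map LinearMap.id 𝓗.ε (M.ρ v)) = M.μ.symm v
  /-- `ρ(h · v) = α(h₂₁) · v₀ ⊗ (B(h₂₂)α⁻¹(v₁))A(S⁻¹(h₁))` -/
  compatibility : ∀ (h : H) (v : M.V),
    M.ρ (M.act h v) = M.compat (TensorProduct.map LinearMap.id 𝓗.Δ (𝓗.Δ h)) (M.ρ v)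

/-- `f` is a morphism from `M` to `N` in the disjoint union of the categories of
`(A, B)`-Yetter-Drinfeld Hom-modules: `M` and `N` lie in the same component, and `f` is `H`-linear
and `H`-colinear. -/
structure IsHom (M N : PreYD 𝓗) (f : M.V →ₗ[k] N.V) : Prop where
  deg_eq : M.deg = N.deg
  map_μ : ∀ v, f (M.μ v) = N.μ (f v)
  map_act : ∀ h v, f (M.act h v) = N.act h (f v)
  map_ρ : ∀ v, N.ρ (f v) = TensorProduct.map f LinearMap.id (M.ρ v)

theorem IsHom.symm {M N : PreYD 𝓗} {f : M.V ≃ₗ[k] N.V} (hf : IsHom M N f.toLinearMap) :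
    IsHom N M f.symm.toLinearMap where
  deg_eq := hf.deg_eq.symm
  map_μ v := f.injective (by simpa using (hf.map_μ (f.symm v)).symm)
  map_act h v := f.injective (by simpa using (hf.map_act h (f.symm v)).symm)
  map_ρ v := by
    have h := hf.map_ρ (f.symm v)
    simp only [LinearEquiv.coe_coe, LinearEquiv.apply_symm_apply] at h
    rw [h, ← LinearMap.comp_apply (TensorProduct.map f.symm.toLinearMap LinearMap.id),
      ← TensorProduct.map_comp]
    simp

/-- The tensor unit `(k, id)`, with `h · x = ε(h)x` and `x ↦ x ⊗ 1`, in the component of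
`(id, id)`. -/
noncomputable abbrev unit (𝓗 : MonoidalHomHopfAlgebraBij k H) : PreYD 𝓗 where
  deg := 1
  V := k
  μ := LinearEquiv.refl k k
  act := LinearMap.mul k k ∘ₗ 𝓗.ε
  ρ := (TensorProduct.mk k k H).flip 𝓗.one

/-- The tensor product: for `M` of index `(A, B)` and `N` of index `(C, D)`,
`h · (m ⊗ n) = C(h₁) · m ⊗ C⁻¹BC(h₂) · n` and `m ⊗ n ↦ (m₀ ⊗ n₀) ⊗ n₁m₁`,
in the component of `(A, B) * (C, D)`. -/
noncomputable abbrev tensor (M N : PreYD 𝓗) : PreYD 𝓗 where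
  deg := M.deg * N.deg
  V := M.V ⊗[k] N.V
  μ := TensorProduct.congr M.μ N.μ
  act := TensorProduct.homTensorHomMap (RingHom.id k) M.V N.V M.V N.V ∘ₗ
    TensorProduct.map (M.act ∘ₗ N.deg.fst.1.toLinearMap)
      (N.act ∘ₗ (N.deg.fst⁻¹ * M.deg.snd * N.deg.fst).1.toLinearMap) ∘ₗ 𝓗.Δ
  ρ := TensorProduct.map LinearMap.id (TensorProduct.lift 𝓗.m.flip) ∘ₗ
    (TensorProduct.tensorTensorTensorComm k M.V H N.V H).toLinearMap ∘ₗ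
    TensorProduct.map M.ρ N.ρ

/-- The conjugate `ᵍN` of `N`: for `g = (A, B)` and `N` of index `(C, D)`, the same space and
automorphism with `h ▷ n = C⁻¹BCA⁻¹(h) · n` and `n ↦ n₀ ⊗ AB⁻¹(n₁)`, in the component of
`(A, B) * (C, D) * (A, B)⁻¹`. -/
noncomputable abbrev conj (g : TwistedPair (AutMHH 𝓗.toMonoidalHomHopfAlgebra)) (N : PreYD 𝓗) :
    PreYD 𝓗 where
  deg := g * N.deg * g⁻¹
  V := N.V
  μ := N.μ
  act := N.act ∘ₗ (N.deg.fst⁻¹ * g.snd * N.deg.fst * g.fst⁻¹).1.toLinearMap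
  ρ := TensorProduct.map LinearMap.id (g.fst * g.snd⁻¹).1.toLinearMap ∘ₗ N.ρ

/-- The associativity constraint `(m ⊗ n) ⊗ p ↦ μ(m) ⊗ (n ⊗ ς⁻¹(p))`. -/
noncomputable def assoc (M N P : PreYD 𝓗) :
    ((M.tensor N).tensor P).V ≃ₗ[k] (M.tensor (N.tensor P)).V :=
  TensorProduct.congr (TensorProduct.congr M.μ (LinearEquiv.refl k N.V)) P.μ.symm ≪≫ₗ
    TensorProduct.assoc k M.V N.V P.V

/-- The left unit constraint `x ⊗ m ↦ xμ(m)`. -/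
noncomputable def leftUnit (M : PreYD 𝓗) : ((unit 𝓗).tensor M).V ≃ₗ[k] M.V :=
  TensorProduct.lid k M.V ≪≫ₗ M.μ

/-- The right unit constraint `m ⊗ x ↦ xμ(m)`. -/
noncomputable def rightUnit (M : PreYD 𝓗) : (M.tensor (unit 𝓗)).V ≃ₗ[k] M.V :=
  TensorProduct.rid k M.V ≪≫ₗ M.μ

/-- The braiding `m ⊗ n ↦ ν(n₀) ⊗ B⁻¹(n₁) · μ⁻¹(m)` for `M` of index `(A, B)`. -/
noncomputable def braid (M N : PreYD 𝓗) :
    (M.tensor N).V →ₗ[k] ((N.conj M.deg).tensor M).V :=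
  TensorProduct.map N.μ.toLinearMap
      (TensorProduct.lift (M.act ∘ₗ (M.deg.snd⁻¹).1.toLinearMap)) ∘ₗ
    (TensorProduct.assoc k N.V H M.V).toLinearMap ∘ₗ
    (TensorProduct.comm k M.V (N.V ⊗[k] H)).toLinearMap ∘ₗ
    TensorProduct.map M.μ.symm.toLinearMap N.ρ

theorem IsHom.tensor {M M' N N' : PreYD 𝓗} {f : M.V →ₗ[k] M'.V} {g : N.V →ₗ[k] N'.V}
    (hf : IsHom M M' f) (hg : IsHom N N' g) :
    IsHom (M.tensor N) (M'.tensor N') (TensorProduct.map f g) where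
  deg_eq := by simp only [hf.deg_eq, hg.deg_eq]
  map_μ v := by
    change M.V ⊗[k] N.V at v
    induction v with
    | zero => simp
    | add x y hx hy => simp only [map_add, hx, hy]
    | tmul x y => simp [hf.map_μ, hg.map_μ]
  map_act h v := by
    change M.V ⊗[k] N.V at v
    simp only [LinearMap.comp_apply, hf.deg_eq, hg.deg_eq]
    induction 𝓗.Δ h with
    | zero => simp
    | add x y hx hy => simp only [map_add, hx, hy, LinearMap.add_apply]
    | tmul a b =>
      induction v with
      | zero => simp
      | add x y hx hy => simp only [map_add, hx, hy]
      | tmul x y => simp [hf.map_act, hg.map_act]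
  map_ρ v := by
    change M.V ⊗[k] N.V at v
    induction v with
    | zero => simp
    | add x y hx hy => simp only [map_add, hx, hy]
    | tmul x y =>
      simp only [LinearMap.comp_apply, TensorProduct.map_tmul, hf.map_ρ, hg.map_ρ]
      induction M.ρ x with
      | zero => simp
      | add x y hx hy => simp only [map_add, hx, hy, TensorProduct.add_tmul]
      | tmul a b =>
        induction N.ρ y with
        | zero => simp
        | add x y hx hy => simp only [map_add, hx, hy, TensorProduct.tmul_add]
        | tmul c d => simp

theorem IsHom.conj {M N : PreYD 𝓗} {f : M.V →ₗ[k] N.V} (hf : IsHom M N f)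
    (g : TwistedPair (AutMHH 𝓗.toMonoidalHomHopfAlgebra)) :
    IsHom (M.conj g) (N.conj g) f where
  deg_eq := by simp only [hf.deg_eq]
  map_μ := hf.map_μ
  map_act h v := by simp only [LinearMap.comp_apply, hf.deg_eq, hf.map_act]
  map_ρ v := by
    simp only [LinearMap.comp_apply, hf.map_ρ]
    induction M.ρ v with
    | zero => simp
    | add x y hx hy => simp only [map_add, hx, hy]
    | tmul a b => simp

end PreYD

/-- The objects of the disjoint union of the categories of `(A, B)`-Yetter-Drinfeld
Hom-modules over all `(A, B)`. -/
structure MHYD (𝓗 : MonoidalHomHopfAlgebraBij k H) where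
  pre : PreYD 𝓗
  isYD : pre.IsYD

namespace MHYD

variable {𝓗 : MonoidalHomHopfAlgebraBij k H}

@[ext]
structure Hom (M N : MHYD 𝓗) where
  lin : M.pre.V →ₗ[k] N.pre.V
  isHom : PreYD.IsHom M.pre N.pre lin

instance : Category (MHYD 𝓗) where
  Hom := Hom
  id M := ⟨LinearMap.id, rfl, fun _ => rfl, fun _ _ => rfl, fun _ => by simp⟩
  comp f g := ⟨g.lin ∘ₗ f.lin, f.isHom.deg_eq.trans g.isHom.deg_eq,
    fun v => by simp [f.isHom.map_μ, g.isHom.map_μ],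
    fun h v => by simp [f.isHom.map_act, g.isHom.map_act],
    fun v => by
      rw [LinearMap.comp_apply, g.isHom.map_ρ, f.isHom.map_ρ, ← LinearMap.comp_apply,
        ← TensorProduct.map_comp, LinearMap.id_comp]⟩

def isoMk {M N : MHYD 𝓗} (e : M.pre.V ≃ₗ[k] N.pre.V)
    (h : PreYD.IsHom M.pre N.pre e.toLinearMap) : M ≅ N where
  hom := ⟨e.toLinearMap, h⟩
  inv := ⟨e.symm.toLinearMap, h.symm⟩
  hom_inv_id := Hom.ext (by ext; exact e.symm_apply_apply _)
  inv_hom_id := Hom.ext (by ext; exact e.apply_symm_apply _)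

variable (𝓗) in
/-- The operations above restrict to Yetter-Drinfeld Hom-modules, and the constraints and the
braiding are `H`-linear and `H`-colinear. -/
structure Closed : Prop where
  unit : (PreYD.unit 𝓗).IsYD
  tensor : ∀ M N : MHYD 𝓗, (M.pre.tensor N.pre).IsYD
  conj : ∀ (g : TwistedPair (AutMHH 𝓗.toMonoidalHomHopfAlgebra)) (N : MHYD 𝓗), (N.pre.conj g).IsYD
  assoc : ∀ M N P : MHYD 𝓗, PreYD.IsHom ((M.pre.tensor N.pre).tensor P.pre)
    (M.pre.tensor (N.pre.tensor P.pre)) (PreYD.assoc M.pre N.pre P.pre).toLinearMap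
  leftUnit : ∀ M : MHYD 𝓗, PreYD.IsHom ((PreYD.unit 𝓗).tensor M.pre) M.pre
    M.pre.leftUnit.toLinearMap
  rightUnit : ∀ M : MHYD 𝓗, PreYD.IsHom (M.pre.tensor (PreYD.unit 𝓗)) M.pre
    M.pre.rightUnit.toLinearMap
  braid : ∀ M N : MHYD 𝓗, PreYD.IsHom (M.pre.tensor N.pre)
    ((N.pre.conj M.pre.deg).tensor M.pre) (PreYD.braid M.pre N.pre)

/-- The tensor product, unit and constraints of the disjoint union. On morphisms the tensor
product is that of linear maps. -/
noncomputable abbrev monoidalStruct (h : Closed 𝓗) : MonoidalCategoryStruct (MHYD 𝓗) where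
  tensorObj M N := ⟨M.pre.tensor N.pre, h.tensor M N⟩
  tensorHom f g := ⟨TensorProduct.map f.lin g.lin, f.isHom.tensor g.isHom⟩
  whiskerLeft X _ _ f := ⟨TensorProduct.map LinearMap.id f.lin, (Hom.isHom (𝟙 X)).tensor f.isHom⟩
  whiskerRight f Y := ⟨TensorProduct.map f.lin LinearMap.id, f.isHom.tensor (Hom.isHom (𝟙 Y))⟩
  tensorUnit := ⟨PreYD.unit 𝓗, h.unit⟩
  associator M N P := isoMk (PreYD.assoc M.pre N.pre P.pre) (h.assoc M N P)
  leftUnitor M := isoMk M.pre.leftUnit (h.leftUnit M)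
  rightUnitor M := isoMk M.pre.rightUnit (h.rightUnit M)

/-- The index of the component of an object. -/
abbrev deg (M : MHYD 𝓗) : TwistedPair (AutMHH 𝓗.toMonoidalHomHopfAlgebra) := M.pre.deg

/-- The conjugation functor `N ↦ ᵍN`, which is the identity on morphisms. -/
noncomputable abbrev conj (h : Closed 𝓗) (g : TwistedPair (AutMHH 𝓗.toMonoidalHomHopfAlgebra)) :
    MHYD 𝓗 ⥤ MHYD 𝓗 where
  obj N := ⟨N.pre.conj g, h.conj g N⟩
  map f := ⟨f.lin, f.isHom.conj g⟩

/-- The braiding as a morphism of the disjoint union. -/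
noncomputable def braiding (h : Closed 𝓗) (M N : MHYD 𝓗) :
    (monoidalStruct h).tensorObj M N ⟶
      (monoidalStruct h).tensorObj ((conj h M.deg).obj N) M :=
  ⟨PreYD.braid M.pre N.pre, h.braid M N⟩

end MHYD

end YetterDrinfeld

/-!
The twist by `α` and `μ` can be removed. On a monoidal Hom-Hopf algebra `H`, the product `α⁻¹(ab)`
and the coproduct `Δ(α(h))` form an ordinary Hopf algebra with antipode `S` and automorphism `α`,
and on a Yetter-Drinfeld Hom-module the action `μ⁻¹(h · v)` and the coaction `ρ(μ(v))` form an
ordinary `(A, B)`-Yetter-Drinfeld module with automorphism `μ` (`PreYD.isYD_iff`). By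
`compat_iff`, the compatibility condition can then be written without antipode as
`h₁ · v₀ ⊗ B(h₂)v₁ = (h₂ · v)₀ ⊗ (h₂ · v)₁A(h₁)`.

In this form, precomposing the action with an automorphism `E` and postcomposing the coaction with
an automorphism `G` turns an `(A, B)`-module into a `(GAE, GBE)`-module (`IsUYD.twist`), which
covers the conjugates `ᵍN`, and the compatibility of `M ⊗ N` follows by using that of `N` and then
that of `M` (`IsUYD.tensor`). The tensor product of Hom-modules is the ordinary one twisted by
`E = α⁻¹` and `G = α`, and `α` is central among the automorphisms, so that the index does not change.

The braiding becomes `m ⊗ n ↦ n₀ ⊗ B⁻¹(n₁) · m` (`PreYD.braid_tmul`), with inverse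
`n ⊗ m ↦ B⁻¹(S(n₁)) · m ⊗ n₀`. It is linear by the compatibility of `N` and colinear by the compatibility
of `M` (`PreYD.isHom_braid`); the two hexagon identities express the coassociativity of the
coaction (`PreYD.braid_tensor_left`) and the associativity of the action
(`PreYD.braid_tensor_right`). That conjugation is a strict action which preserves tensor products
is a computation with products of automorphisms (`PreYD.conj_mul`, `PreYD.conj_tensor`): all
objects that have to be equal have the same underlying space, and the morphisms `eqToHom` between
them are identity maps.
-/

/-! ### Sweedler sums -/

section Sweedler

open TensorProduct

variable {k : Type*} [Field k] {A B C D E X Y : Type*}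
  [AddCommGroup A] [Module k A] [AddCommGroup B] [Module k B] [AddCommGroup C] [Module k C]
  [AddCommGroup D] [Module k D] [AddCommGroup E] [Module k E]
  [AddCommGroup X] [AddCommGroup Y]

/-- The Sweedler sum `∑ f(t₁, t₂)` over a chosen expression `t = ∑ t₁ ⊗ t₂`. It is defined for every
function `f`, so that sums can be nested and rewritten without bundling; for bilinear `f` it is
independent of the choice, see `IsBilin.sw_eq`. -/
noncomputable def sw (t : A ⊗[k] B) (f : A → B → X) : X :=
  ∑ p ∈ (TensorProduct.exists_finset t).choose, f p.1 p.2

/-- An unbundled function of two variables is bilinear. The hypotheses of this form in the lemmas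
on Sweedler sums are discharged by `simp`. -/
structure IsBilin (k : Type*) [Field k] {A B X : Type*} [AddCommGroup A] [Module k A]
    [AddCommGroup B] [Module k B] [AddCommGroup X] [Module k X] (f : A → B → X) : Prop where
  left : ∀ b, IsLinearMap k fun a => f a b
  right : ∀ a, IsLinearMap k fun b => f a b

/-- An unbundled function of three variables is trilinear. -/
structure IsTrilin (k : Type*) [Field k] {A B C X : Type*} [AddCommGroup A] [Module k A]
    [AddCommGroup B] [Module k B] [AddCommGroup C] [Module k C] [AddCommGroup X] [Module k X]
    (f : A → B → C → X) : Prop where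
  left : ∀ b c, IsLinearMap k fun a => f a b c
  mid : ∀ a c, IsLinearMap k fun b => f a b c
  right : ∀ a b, IsLinearMap k fun c => f a b c

theorem sw_tmul_self (t : A ⊗[k] B) : sw t (fun a b => a ⊗ₜ[k] b) = t :=
  (TensorProduct.exists_finset t).choose_spec.symm

theorem map_sw {F : Type*} [FunLike F X Y] [AddMonoidHomClass F X Y] (g : F) (t : A ⊗[k] B)
    (f : A → B → X) : g (sw t f) = sw t fun a b => g (f a b) :=
  map_sum g _ _

theorem apply_eq_sw {F : Type*} [FunLike F (A ⊗[k] B) Y] [AddMonoidHomClass F (A ⊗[k] B) Y]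
    (g : F) (t : A ⊗[k] B) : g t = sw t fun a b => g (a ⊗ₜ[k] b) := by
  conv_lhs => rw [← sw_tmul_self t]
  rw [map_sw]

theorem sw_congr {t : A ⊗[k] B} {f g : A → B → X} (h : ∀ a b, f a b = g a b) : sw t f = sw t g :=
  Finset.sum_congr rfl fun _ _ => h _ _

theorem sw_comm (t : A ⊗[k] B) (s : C ⊗[k] D) (f : A → B → C → D → X) :
    sw t (fun a b => sw s fun c d => f a b c d) = sw s fun c d => sw t fun a b => f a b c d :=
  Finset.sum_comm

theorem sw_fun_add (t : A ⊗[k] B) (f g : A → B → X) :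
    sw t (fun a b => f a b + g a b) = sw t f + sw t g :=
  Finset.sum_add_distrib

variable [Module k X] [Module k Y]

theorem sw_fun_smul (c : k) (t : A ⊗[k] B) (f : A → B → X) :
    sw t (fun a b => c • f a b) = c • sw t f :=
  Finset.smul_sum.symm

theorem sw_tmul_right (t : A ⊗[k] B) (f : A → B → X) (y : Y) :
    sw t f ⊗ₜ[k] y = sw t fun a b => f a b ⊗ₜ[k] y :=
  TensorProduct.sum_tmul _ _ _

theorem sw_tmul_left (t : A ⊗[k] B) (f : A → B → X) (y : Y) :
    y ⊗ₜ[k] sw t f = sw t fun a b => y ⊗ₜ[k] f a b :=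
  TensorProduct.tmul_sum _ _ _

/-- The linear map on a tensor product given by a bilinear function. -/
def IsBilin.lift {f : A → B → X} (hf : IsBilin k f) : A ⊗[k] B →ₗ[k] X :=
  TensorProduct.lift (LinearMap.mk₂ k f (fun a a' b => (hf.left b).map_add a a')
    (fun c a b => (hf.left b).map_smul c a) (fun a => (hf.right a).map_add)
    (fun c a b => (hf.right a).map_smul c b))

@[simp]
theorem IsBilin.lift_tmul {f : A → B → X} (hf : IsBilin k f) (a : A) (b : B) :
    hf.lift (a ⊗ₜ[k] b) = f a b := rfl

theorem IsBilin.sw_eq {f : A → B → X} (hf : IsBilin k f) (t : A ⊗[k] B) :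
    sw t f = hf.lift t := by
  rw [apply_eq_sw hf.lift]; rfl

theorem sw_tmul (a : A) (b : B) {f : A → B → X}
    (hf : IsBilin k f := by simp) : sw (a ⊗ₜ[k] b) f = f a b := by
  rw [hf.sw_eq]; rfl

theorem isLinearMap_iff (f : A → X) : IsLinearMap k f ↔
    (∀ a b, f (a + b) = f a + f b) ∧ ∀ (c : k) (a : A), f (c • a) = c • f a :=
  ⟨fun h => ⟨h.1, h.2⟩, fun h => ⟨h.1, h.2⟩⟩

theorem isBilin_iff (f : A → B → X) : IsBilin k f ↔
    (∀ b, IsLinearMap k fun a => f a b) ∧ ∀ a, IsLinearMap k fun b => f a b :=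
  ⟨fun h => ⟨h.1, h.2⟩, fun h => ⟨h.1, h.2⟩⟩

theorem isTrilin_iff (f : A → B → C → X) : IsTrilin k f ↔
    (∀ b c, IsLinearMap k fun a => f a b c) ∧ (∀ a c, IsLinearMap k fun b => f a b c) ∧
      ∀ a b, IsLinearMap k fun c => f a b c :=
  ⟨fun h => ⟨h.1, h.2, h.3⟩, fun h => ⟨h.1, h.2.1, h.2.2⟩⟩

theorem sw_add {f : A → B → X} (hf : IsBilin k f) (s t : A ⊗[k] B) :
    sw (s + t) f = sw s f + sw t f := by
  simp only [hf.sw_eq, map_add]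

theorem sw_smul {f : A → B → X} (hf : IsBilin k f) (c : k) (t : A ⊗[k] B) :
    sw (c • t) f = c • sw t f := by
  simp only [hf.sw_eq, map_smul]

theorem sw_zero {f : A → B → X} (hf : IsBilin k f) : sw (0 : A ⊗[k] B) f = 0 := by
  simp only [hf.sw_eq, map_zero]

theorem smul_tmul_eq (c : k) (a : A) (b : B) : (c • a) ⊗ₜ[k] b = c • a ⊗ₜ[k] b :=
  (TensorProduct.smul_tmul' c a b).symm

-- With these rules `simp` proves that a function given by a formula is linear in each variable.
attribute [simp] isLinearMap_iff isBilin_iff isTrilin_iff sw_add sw_smul sw_zero sw_fun_add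
  sw_fun_smul smul_tmul_eq TensorProduct.add_tmul TensorProduct.tmul_add

theorem isBilin_smul (e : B →ₗ[k] k) : IsBilin k fun (x : X) (b : B) => e b • x where
  left b := ⟨smul_add _, fun c x => smul_comm _ _ _⟩
  right x := ⟨fun b b' => by simp [add_smul], fun c b => by simp [mul_smul]⟩

/-- The linear map on a triple tensor product given by a trilinear function. -/
def IsTrilin.lift {f : A → B → C → X} (hf : IsTrilin k f) : A ⊗[k] (B ⊗[k] C) →ₗ[k] X :=
  TensorProduct.lift
    { toFun := fun a => IsBilin.lift (f := f a) ⟨fun c => hf.mid a c, fun b => hf.right a b⟩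
      map_add' := fun a a' => TensorProduct.ext' fun b c => (hf.left b c).map_add a a'
      map_smul' := fun r a => TensorProduct.ext' fun b c => (hf.left b c).map_smul r a }

@[simp]
theorem IsTrilin.lift_tmul {f : A → B → C → X} (hf : IsTrilin k f) (a : A) (b : B) (c : C) :
    hf.lift (a ⊗ₜ[k] (b ⊗ₜ[k] c)) = f a b c := rfl

theorem IsBilin.comp {f : A → B → X} (hf : IsBilin k f) (g : C →ₗ[k] A) (h : D →ₗ[k] B) :
    IsBilin k fun c d => f (g c) (h d) where
  left d := ⟨fun c c' => by rw [map_add, (hf.left _).map_add],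
    fun r c => by rw [map_smul, (hf.left _).map_smul]⟩
  right c := ⟨fun d d' => by rw [map_add, (hf.right _).map_add],
    fun r d => by rw [map_smul, (hf.right _).map_smul]⟩

theorem sw_apply_sw (t : A ⊗[k] B) (g : A → B → C ⊗[k] D) {f : C → D → X}
    (hf : IsBilin k f := by simp) :
    sw (sw t g) f = sw t fun a b => sw (g a b) f := by
  simp only [hf.sw_eq]; exact map_sw _ _ _

theorem sw_map (g : A →ₗ[k] C) (h : B →ₗ[k] D) (t : A ⊗[k] B) {f : C → D → X}
    (hf : IsBilin k f := by simp) :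
    sw (TensorProduct.map g h t) f = sw t fun a b => f (g a) (h b) := by
  rw [apply_eq_sw (TensorProduct.map g h), sw_apply_sw _ _ hf]
  exact sw_congr fun a b => sw_tmul _ _ hf

end Sweedler

/-! ### The untwisted Hopf algebra -/

section Untwisted

variable {k H : Type u} [Field k] [AddCommGroup H] [Module k H]

namespace MonoidalHomHopfAlgebra

variable (𝓗 : MonoidalHomHopfAlgebra k H)

/-- The untwisted product `α⁻¹(ab)`, which is associative with unit `1`. -/
noncomputable def mul : H →ₗ[k] H →ₗ[k] H := 𝓗.m.compr₂ 𝓗.α.symm.toLinearMap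

/-- The untwisted coproduct `Δ(α(h))`, which is coassociative with counit `ε` and multiplicative
for `mul`. -/
noncomputable def comul : H →ₗ[k] H ⊗[k] H := 𝓗.Δ ∘ₗ 𝓗.α.toLinearMap

theorem m_eq (a b : H) : 𝓗.m a b = 𝓗.α (𝓗.mul a b) := by simp [mul]

theorem Δ_eq (h : H) : 𝓗.Δ h = 𝓗.comul (𝓗.α.symm h) := by simp [comul]

/-- The structure map `α`, which is itself an automorphism of the monoidal Hom-Hopf algebra. It
is central in `AutMHH 𝓗`, see `αAut_mul`. -/
def αAut : AutMHH 𝓗 :=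
  ⟨𝓗.α, fun _ => rfl, 𝓗.α_mul, 𝓗.α_one, 𝓗.comul_α, 𝓗.counit_α⟩

variable {𝓗}

theorem αAut_mul (A : AutMHH 𝓗) : 𝓗.αAut * A = A * 𝓗.αAut :=
  Subtype.ext (LinearEquiv.ext fun h => (A.2.1 h).symm)

theorem aut_mul_apply (A B : AutMHH 𝓗) (h : H) : (A * B).1 h = A.1 (B.1 h) := rfl

@[simp] theorem aut_apply_inv (A : AutMHH 𝓗) (h : H) : A.1 (A⁻¹.1 h) = h :=
  A.1.apply_symm_apply h

@[simp] theorem aut_inv_apply (A : AutMHH 𝓗) (h : H) : A⁻¹.1 (A.1 h) = h :=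
  A.1.symm_apply_apply h

theorem aut_m (A : AutMHH 𝓗) (a b : H) : A.1 (𝓗.m a b) = 𝓗.m (A.1 a) (A.1 b) := A.2.2.1 a b

theorem aut_one (A : AutMHH 𝓗) : A.1 𝓗.one = 𝓗.one := A.2.2.2.1

theorem aut_α (A : AutMHH 𝓗) (a : H) : A.1 (𝓗.α a) = 𝓗.α (A.1 a) := A.2.1 a

theorem aut_α_symm (A : AutMHH 𝓗) (a : H) : A.1 (𝓗.α.symm a) = 𝓗.α.symm (A.1 a) := by
  apply 𝓗.α.injective
  rw [← aut_α]
  simp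

theorem aut_counit (A : AutMHH 𝓗) (a : H) : 𝓗.ε (A.1 a) = 𝓗.ε a := A.2.2.2.2.2 a

theorem aut_mul (A : AutMHH 𝓗) (a b : H) : A.1 (𝓗.mul a b) = 𝓗.mul (A.1 a) (A.1 b) := by
  simp [mul, aut_α_symm, aut_m]

theorem aut_Δ (A : AutMHH 𝓗) (a : H) :
    𝓗.Δ (A.1 a) = TensorProduct.map A.1.toLinearMap A.1.toLinearMap (𝓗.Δ a) := A.2.2.2.2.1 a

theorem aut_comul (A : AutMHH 𝓗) (a : H) :
    𝓗.comul (A.1 a) = TensorProduct.map A.1.toLinearMap A.1.toLinearMap (𝓗.comul a) := by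
  simp [comul, ← aut_α, aut_Δ]

theorem sw_comul_aut {X : Type*} [AddCommGroup X] [Module k X] (A : AutMHH 𝓗) (a : H)
    {f : H → H → X} (hf : IsBilin k f := by simp) :
    sw (𝓗.comul (A.1 a)) f = sw (𝓗.comul a) fun x y => f (A.1 x) (A.1 y) := by
  rw [aut_comul, sw_map _ _ _ hf]; rfl

theorem sw_Δ_aut {X : Type*} [AddCommGroup X] [Module k X] (A : AutMHH 𝓗) (a : H)
    {f : H → H → X} (hf : IsBilin k f := by simp) :
    sw (𝓗.Δ (A.1 a)) f = sw (𝓗.Δ a) fun x y => f (A.1 x) (A.1 y) := by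
  rw [aut_Δ, sw_map _ _ _ hf]; rfl

theorem α_mul' (a b : H) : 𝓗.α (𝓗.mul a b) = 𝓗.mul (𝓗.α a) (𝓗.α b) := aut_mul 𝓗.αAut a b

theorem mul_assoc' (a b c : H) : 𝓗.mul (𝓗.mul a b) c = 𝓗.mul a (𝓗.mul b c) := by
  have h := 𝓗.hom_assoc a b c
  simp only [m_eq, ← α_mul'] at h
  exact (𝓗.α.injective (𝓗.α.injective h)).symm

@[simp] theorem mul_one' (a : H) : 𝓗.mul a 𝓗.one = a := by simp [mul, 𝓗.mul_one]

@[simp] theorem one_mul' (a : H) : 𝓗.mul 𝓗.one a = a := by simp [mul, 𝓗.one_mul]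

section

variable {X : Type*} [AddCommGroup X] [Module k X]

theorem sw_Δ (h : H) {f : H → H → X} (hf : IsBilin k f := by simp) :
    sw (𝓗.Δ h) f = sw (𝓗.comul h) fun a b => f (𝓗.α.symm a) (𝓗.α.symm b) := by
  rw [Δ_eq]
  exact sw_comul_aut 𝓗.αAut⁻¹ h hf

theorem sw_comul (h : H) {f : H → H → X} (hf : IsBilin k f := by simp) :
    sw (𝓗.comul h) f = sw (𝓗.Δ h) fun a b => f (𝓗.α a) (𝓗.α b) :=
  sw_Δ_aut 𝓗.αAut h hf

/-- Coassociativity of the untwisted coproduct: the Hom-coassociativity of `Δ` at `α²(h)`. -/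
theorem coassoc_tensor (h : H) :
    (sw (𝓗.comul h) fun a b => sw (𝓗.comul a) fun x y => x ⊗ₜ[k] (y ⊗ₜ[k] b)) =
      sw (𝓗.comul h) fun a b => sw (𝓗.comul b) fun x y => a ⊗ₜ[k] (x ⊗ₜ[k] y) := by
  have e := 𝓗.hom_coassoc (𝓗.α (𝓗.α h))
  have hΔ : 𝓗.Δ (𝓗.α (𝓗.α h)) = 𝓗.comul (𝓗.αAut.1 h) := rfl
  rw [apply_eq_sw (TensorProduct.map _ _), apply_eq_sw (TensorProduct.map _ _), map_sw, hΔ,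
    sw_comul_aut, sw_comul_aut] at e
  simp only [TensorProduct.map_tmul, LinearEquiv.coe_coe] at e
  have hl : ∀ a b : H, (sw (𝓗.comul b) fun x y => a ⊗ₜ[k] (x ⊗ₜ[k] y)) =
      𝓗.α.symm (𝓗.αAut.1 a) ⊗ₜ[k] 𝓗.Δ (𝓗.αAut.1 b) := fun a b => by
    rw [← sw_tmul_left, sw_tmul_self]
    exact congrArg (· ⊗ₜ[k] 𝓗.comul b) (𝓗.α.symm_apply_apply a).symm
  have hr : ∀ a b : H, (sw (𝓗.comul a) fun x y => x ⊗ₜ[k] (y ⊗ₜ[k] b)) =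
      TensorProduct.assoc k H H H (𝓗.Δ (𝓗.αAut.1 a) ⊗ₜ[k] 𝓗.α.symm (𝓗.αAut.1 b)) := fun a b => by
    rw [← sw_tmul_self (𝓗.Δ (𝓗.αAut.1 a)), sw_tmul_right, map_sw]
    refine sw_congr fun x y => ?_
    rw [TensorProduct.assoc_tmul]
    exact congrArg (fun b => x ⊗ₜ[k] (y ⊗ₜ[k] b)) (𝓗.α.symm_apply_apply b).symm
  rw [sw_congr hr, sw_congr hl, e]

theorem sw_comul_coassoc (h : H) {f : H → H → H → X} (hf : IsTrilin k f := by simp) :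
    (sw (𝓗.comul h) fun a b => sw (𝓗.comul a) fun x y => f x y b) =
      sw (𝓗.comul h) fun a b => sw (𝓗.comul b) fun x y => f a x y := by
  simpa only [map_sw, IsTrilin.lift_tmul] using congrArg hf.lift (coassoc_tensor (𝓗 := 𝓗) h)

theorem sw_counit_right (h : H) {f : H → X} (hf : IsLinearMap k f := by simp) :
    (sw (𝓗.comul h) fun a b => 𝓗.ε b • f a) = f h := by
  have e := congrArg (hf.mk' f) (𝓗.counit_right (𝓗.α h))
  rw [apply_eq_sw (TensorProduct.map _ _), map_sw, map_sw] at e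
  simpa [comul] using e

theorem sw_counit_left (h : H) {f : H → X} (hf : IsLinearMap k f := by simp) :
    (sw (𝓗.comul h) fun a b => 𝓗.ε a • f b) = f h := by
  have e := congrArg (hf.mk' f) (𝓗.counit_left (𝓗.α h))
  rw [apply_eq_sw (TensorProduct.map _ _), map_sw, map_sw] at e
  simpa [comul] using e

theorem comul_mul' (a b : H) : 𝓗.comul (𝓗.mul a b) =
    sw (𝓗.comul a) fun x y => sw (𝓗.comul b) fun z w => 𝓗.mul x z ⊗ₜ[k] 𝓗.mul y w := by
  have e : 𝓗.comul (𝓗.mul a b) = 𝓗.Δ (𝓗.m a b) := by simp [comul, mul]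
  rw [e, 𝓗.comul_mul, sw_comul, ← LinearMap.flip_apply,
    apply_eq_sw ((TensorProduct.map₂ 𝓗.m 𝓗.m).flip (𝓗.Δ b))]
  refine sw_congr fun x y => ?_
  rw [LinearMap.flip_apply, apply_eq_sw (TensorProduct.map₂ 𝓗.m 𝓗.m (x ⊗ₜ[k] y)), sw_comul]
  refine sw_congr fun z w => ?_
  simp [mul, ← 𝓗.α_mul]

theorem sw_comul_mul (a b : H) {f : H → H → X} (hf : IsBilin k f := by simp) :
    sw (𝓗.comul (𝓗.mul a b)) f =
      sw (𝓗.comul a) fun x y => sw (𝓗.comul b) fun z w => f (𝓗.mul x z) (𝓗.mul y w) := by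
  rw [comul_mul', sw_apply_sw _ _ hf]
  refine sw_congr fun x y => ?_
  rw [sw_apply_sw _ _ hf]
  exact sw_congr fun z w => sw_tmul _ _ hf

theorem sw_comul_one {f : H → H → X} (hf : IsBilin k f := by simp) :
    sw (𝓗.comul 𝓗.one) f = f 𝓗.one 𝓗.one := by
  simp only [comul, LinearMap.comp_apply, LinearEquiv.coe_coe, 𝓗.α_one, 𝓗.comul_one]
  exact sw_tmul _ _ hf

theorem sw_antipode_left (h : H) {f : H → X} (hf : IsLinearMap k f := by simp) :
    (sw (𝓗.comul h) fun a b => f (𝓗.mul (𝓗.S a) b)) = 𝓗.ε h • f 𝓗.one := by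
  have e := congrArg (fun x => hf.mk' f (𝓗.α.symm x)) (𝓗.antipode_left (𝓗.α h))
  rw [apply_eq_sw (TensorProduct.lift _), map_sw, map_sw] at e
  simpa [comul, mul, 𝓗.counit_α, (LinearEquiv.symm_apply_eq _).2 𝓗.α_one.symm] using e

theorem sw_antipode_right (h : H) {f : H → X} (hf : IsLinearMap k f := by simp) :
    (sw (𝓗.comul h) fun a b => f (𝓗.mul a (𝓗.S b))) = 𝓗.ε h • f 𝓗.one := by
  have e := congrArg (fun x => hf.mk' f (𝓗.α.symm x)) (𝓗.antipode_right (𝓗.α h))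
  rw [apply_eq_sw (TensorProduct.lift _), map_sw, map_sw] at e
  simpa [comul, mul, 𝓗.counit_α, (LinearEquiv.symm_apply_eq _).2 𝓗.α_one.symm] using e

end

end MonoidalHomHopfAlgebra

end Untwisted

/-! ### The antipode -/

section Antipode

variable {k H : Type u} [Field k] [AddCommGroup H] [Module k H]

namespace MonoidalHomHopfAlgebra

variable {𝓗 : MonoidalHomHopfAlgebra k H}

theorem S_one : 𝓗.S 𝓗.one = 𝓗.one := by
  have h := sw_antipode_left (𝓗 := 𝓗) 𝓗.one (f := fun x => x)
  rw [sw_comul_one] at h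
  simpa [𝓗.counit_one] using h

theorem S_α_symm (a : H) : 𝓗.S (𝓗.α.symm a) = 𝓗.α.symm (𝓗.S a) := by
  apply 𝓗.α.injective
  rw [← 𝓗.S_α]
  simp

theorem counit_mul' (a b : H) : 𝓗.ε (𝓗.mul a b) = 𝓗.ε a * 𝓗.ε b := by
  rw [← 𝓗.counit_mul, m_eq, 𝓗.counit_α]

/-- The antipode reverses products: both sides are convolution inverse to the product. -/
theorem S_mul (a b : H) : 𝓗.S (𝓗.mul a b) = 𝓗.mul (𝓗.S b) (𝓗.S a) := by
  have hP : ∀ a b z : H, (sw (𝓗.comul a) fun a₂ a₃ => sw (𝓗.comul b) fun b₂ b₃ =>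
      𝓗.mul z (𝓗.mul (𝓗.mul a₂ b₂) (𝓗.mul (𝓗.S b₃) (𝓗.S a₃)))) = 𝓗.ε a • 𝓗.ε b • z := by
    intro a b z
    have h1 : ∀ a₂ a₃ : H, (sw (𝓗.comul b) fun b₂ b₃ =>
        𝓗.mul z (𝓗.mul (𝓗.mul a₂ b₂) (𝓗.mul (𝓗.S b₃) (𝓗.S a₃)))) =
          𝓗.ε b • 𝓗.mul z (𝓗.mul a₂ (𝓗.S a₃)) := fun a₂ a₃ => by
      have h := sw_antipode_right (𝓗 := 𝓗) b
        (f := fun x => 𝓗.mul z (𝓗.mul a₂ (𝓗.mul x (𝓗.S a₃))))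
      simpa only [mul_assoc', one_mul'] using h
    rw [sw_congr h1, sw_fun_smul,
      sw_antipode_right a (f := fun x => 𝓗.mul z x), mul_one', smul_comm]
  have hQ : ∀ a b z : H, (sw (𝓗.comul a) fun a₁ a₂ => sw (𝓗.comul b) fun b₁ b₂ =>
      𝓗.mul (𝓗.S (𝓗.mul a₁ b₁)) (𝓗.mul (𝓗.mul a₂ b₂) z)) = 𝓗.ε a • 𝓗.ε b • z := by
    intro a b z
    have h := sw_antipode_left (𝓗 := 𝓗) (𝓗.mul a b) (f := fun x => 𝓗.mul x z)
    rw [sw_comul_mul] at h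
    simpa only [mul_assoc', one_mul', counit_mul', mul_smul] using h
  calc 𝓗.S (𝓗.mul a b)
      = sw (𝓗.comul a) fun a₁ a' => sw (𝓗.comul b) fun b₁ b' =>
          𝓗.ε a' • 𝓗.ε b' • 𝓗.S (𝓗.mul a₁ b₁) := by
        simp only [sw_fun_smul]
        rw [← sw_counit_right (𝓗 := 𝓗) a (f := fun x => 𝓗.S (𝓗.mul x b))]
        refine sw_congr fun a₁ a' => ?_
        rw [sw_counit_right b (f := fun x => 𝓗.S (𝓗.mul a₁ x))]
    _ = sw (𝓗.comul a) fun a₁ a' => sw (𝓗.comul b) fun b₁ b' =>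
          sw (𝓗.comul a') fun a₂ a₃ => sw (𝓗.comul b') fun b₂ b₃ =>
          𝓗.mul (𝓗.S (𝓗.mul a₁ b₁)) (𝓗.mul (𝓗.mul a₂ b₂) (𝓗.mul (𝓗.S b₃) (𝓗.S a₃))) := by
        simp only [hP]
    _ = sw (𝓗.comul a) fun a₁ a' => sw (𝓗.comul a') fun a₂ a₃ =>
          sw (𝓗.comul b) fun b₁ b' => sw (𝓗.comul b') fun b₂ b₃ =>
          𝓗.mul (𝓗.S (𝓗.mul a₁ b₁)) (𝓗.mul (𝓗.mul a₂ b₂) (𝓗.mul (𝓗.S b₃) (𝓗.S a₃))) :=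
        sw_congr fun a₁ a' => sw_comm _ _ _
    _ = sw (𝓗.comul a) fun a' a₃ => sw (𝓗.comul a') fun a₁ a₂ =>
          sw (𝓗.comul b) fun b₁ b' => sw (𝓗.comul b') fun b₂ b₃ =>
          𝓗.mul (𝓗.S (𝓗.mul a₁ b₁)) (𝓗.mul (𝓗.mul a₂ b₂) (𝓗.mul (𝓗.S b₃) (𝓗.S a₃))) :=
        (sw_comul_coassoc a).symm
    _ = sw (𝓗.comul a) fun a' a₃ => sw (𝓗.comul a') fun a₁ a₂ =>
          sw (𝓗.comul b) fun b' b₃ => sw (𝓗.comul b') fun b₁ b₂ =>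
          𝓗.mul (𝓗.S (𝓗.mul a₁ b₁)) (𝓗.mul (𝓗.mul a₂ b₂) (𝓗.mul (𝓗.S b₃) (𝓗.S a₃))) :=
        sw_congr fun a' a₃ => sw_congr fun a₁ a₂ => (sw_comul_coassoc b).symm
    _ = sw (𝓗.comul a) fun a' a₃ => sw (𝓗.comul b) fun b' b₃ =>
          sw (𝓗.comul a') fun a₁ a₂ => sw (𝓗.comul b') fun b₁ b₂ =>
          𝓗.mul (𝓗.S (𝓗.mul a₁ b₁)) (𝓗.mul (𝓗.mul a₂ b₂) (𝓗.mul (𝓗.S b₃) (𝓗.S a₃))) :=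
        sw_congr fun a' a₃ => sw_comm _ _ _
    _ = sw (𝓗.comul a) fun a' a₃ => sw (𝓗.comul b) fun b' b₃ =>
          𝓗.ε a' • 𝓗.ε b' • 𝓗.mul (𝓗.S b₃) (𝓗.S a₃) := by
        simp only [hQ]
    _ = 𝓗.mul (𝓗.S b) (𝓗.S a) := by
        simp only [sw_fun_smul]
        rw [← sw_counit_left (𝓗 := 𝓗) a (f := fun x => 𝓗.mul (𝓗.S b) (𝓗.S x))]
        refine sw_congr fun a' a₃ => ?_
        rw [sw_counit_left b (f := fun x => 𝓗.mul (𝓗.S x) (𝓗.S a₃))]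

end MonoidalHomHopfAlgebra

namespace MonoidalHomHopfAlgebraBij

open MonoidalHomHopfAlgebra

variable {𝓗 : MonoidalHomHopfAlgebraBij k H}

@[simp]
theorem S_Sinv (a : H) : 𝓗.S (𝓗.Sinv a) = a :=
  (LinearEquiv.ofBijective 𝓗.S 𝓗.S_bijective).apply_symm_apply a

theorem Sinv_α_symm (a : H) : 𝓗.Sinv (𝓗.α.symm a) = 𝓗.α.symm (𝓗.Sinv a) := by
  apply 𝓗.S_bijective.injective
  rw [S_α_symm, S_Sinv, S_Sinv]

section

variable {X : Type*} [AddCommGroup X] [Module k X]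

/-- `h₂S⁻¹(h₁) = ε(h)1`, the image of `h₁S(h₂) = ε(h)1` under the antiautomorphism `S⁻¹`. -/
theorem sw_Sinv_right (h : H) {f : H → X} (hf : IsLinearMap k f := by simp) :
    (sw (𝓗.comul h) fun a b => f (𝓗.mul b (𝓗.Sinv a))) = 𝓗.ε h • f 𝓗.one := by
  have e : (sw (𝓗.comul h) fun a b => 𝓗.mul b (𝓗.Sinv a)) = 𝓗.ε h • 𝓗.one := by
    apply 𝓗.S_bijective.injective
    rw [map_sw, map_smul, S_one, ← sw_antipode_right h (f := fun x => x)]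
    exact sw_congr fun a b => by rw [S_mul, S_Sinv]
  simpa [map_sw] using congrArg (hf.mk' f) e

/-- `S⁻¹(h₂)h₁ = ε(h)1`, the image of `S(h₁)h₂ = ε(h)1` under the antiautomorphism `S⁻¹`. -/
theorem sw_Sinv_left (h : H) {f : H → X} (hf : IsLinearMap k f := by simp) :
    (sw (𝓗.comul h) fun a b => f (𝓗.mul (𝓗.Sinv b) a)) = 𝓗.ε h • f 𝓗.one := by
  have e : (sw (𝓗.comul h) fun a b => 𝓗.mul (𝓗.Sinv b) a) = 𝓗.ε h • 𝓗.one := by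
    apply 𝓗.S_bijective.injective
    rw [map_sw, map_smul, S_one, ← sw_antipode_left h (f := fun x => x)]
    exact sw_congr fun a b => by rw [S_mul, S_Sinv]
  simpa [map_sw] using congrArg (hf.mk' f) e

end

end MonoidalHomHopfAlgebraBij

end Antipode

/-! ### Untwisted Yetter-Drinfeld modules -/

section UntwistedModules

variable {k H : Type u} [Field k] [AddCommGroup H] [Module k H]

open MonoidalHomHopfAlgebra

/-- An ordinary `(A, B)`-Yetter-Drinfeld module over the untwisted Hopf algebra `(H, mul, comul)`,
with an automorphism `μ` that is compatible with the action and the coaction along `α`. The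
compatibility `h₁ · v₀ ⊗ B(h₂)v₁ = (h₂ · v)₀ ⊗ (h₂ · v)₁A(h₁)` of action and coaction is stated
without the antipode. -/
structure IsUYD (𝓗 : MonoidalHomHopfAlgebra k H) (A B : AutMHH 𝓗) {V : Type u} [AddCommGroup V]
    [Module k V] (μ : V ≃ₗ[k] V) (act : H →ₗ[k] V →ₗ[k] V) (ρ : V →ₗ[k] V ⊗[k] H) : Prop where
  mul_act : ∀ a b v, act (𝓗.mul a b) v = act a (act b v)
  one_act : ∀ v, act 𝓗.one v = v
  μ_act : ∀ a v, μ (act a v) = act (𝓗.α a) (μ v)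
  coassoc : ∀ v, (sw (ρ v) fun x a => sw (ρ x) fun y b => y ⊗ₜ[k] (b ⊗ₜ[k] a)) =
    sw (ρ v) fun x a => sw (𝓗.comul a) fun b c => x ⊗ₜ[k] (b ⊗ₜ[k] c)
  ρ_μ : ∀ v, ρ (μ v) = TensorProduct.map μ.toLinearMap 𝓗.α.toLinearMap (ρ v)
  counit : ∀ v, (sw (ρ v) fun x a => 𝓗.ε a • x) = v
  compat : ∀ h v, (sw (𝓗.comul h) fun a b => sw (ρ v) fun x c => act a x ⊗ₜ[k] 𝓗.mul (B.1 b) c) =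
    sw (𝓗.comul h) fun a b => sw (ρ (act b v)) fun x c => x ⊗ₜ[k] 𝓗.mul c (A.1 a)

namespace IsUYD

section

variable {𝓗 : MonoidalHomHopfAlgebra k H} {A B : AutMHH 𝓗} {V : Type u} [AddCommGroup V]
    [Module k V] {μ : V ≃ₗ[k] V} {act : H →ₗ[k] V →ₗ[k] V} {ρ : V →ₗ[k] V ⊗[k] H}
    {X : Type*} [AddCommGroup X] [Module k X]

theorem sw_coassoc (M : IsUYD 𝓗 A B μ act ρ) (v : V) {f : V → H → H → X}
    (hf : IsTrilin k f := by simp) :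
    (sw (ρ v) fun x a => sw (ρ x) fun y b => f y b a) =
      sw (ρ v) fun x a => sw (𝓗.comul a) fun b c => f x b c := by
  simpa only [map_sw, IsTrilin.lift_tmul] using congrArg hf.lift (M.coassoc v)

theorem sw_μ (M : IsUYD 𝓗 A B μ act ρ) (v : V) {f : V → H → X}
    (hf : IsBilin k f := by simp) :
    sw (ρ (μ v)) f = sw (ρ v) fun x a => f (μ x) (𝓗.α a) := by
  rw [M.ρ_μ, sw_map _ _ _ hf]; rfl

theorem sw_counit (M : IsUYD 𝓗 A B μ act ρ) (v : V) {f : V → X}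
    (hf : IsLinearMap k f := by simp) :
    (sw (ρ v) fun x a => 𝓗.ε a • f x) = f v := by
  simpa [map_sw] using congrArg (hf.mk' f) (M.counit v)

theorem sw_compat (M : IsUYD 𝓗 A B μ act ρ) (h : H) (v : V) {f : V → H → X}
    (hf : IsBilin k f := by simp) :
    (sw (𝓗.comul h) fun a b => sw (ρ v) fun x c => f (act a x) (𝓗.mul (B.1 b) c)) =
    sw (𝓗.comul h) fun a b => sw (ρ (act b v)) fun x c => f x (𝓗.mul c (A.1 a)) := by
  simpa only [map_sw, IsBilin.lift_tmul] using congrArg hf.lift (M.compat h v)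

end

end IsUYD

/-- The compatibility condition of Yetter-Drinfeld modules in the form
`ρ(h · v) = h₂ · v₀ ⊗ B(h₃)v₁A(S⁻¹(h₁))` is equivalent to the one without antipode. -/
theorem compat_iff {𝓗 : MonoidalHomHopfAlgebraBij k H}
    {A B : AutMHH 𝓗.toMonoidalHomHopfAlgebra} {V : Type u} [AddCommGroup V]
    [Module k V] {act : H →ₗ[k] V →ₗ[k] V} {ρ : V →ₗ[k] V ⊗[k] H} :
    (∀ h v, ρ (act h v) = sw (𝓗.comul h) fun x t => sw (𝓗.comul t) fun y z =>
      sw (ρ v) fun u w => act y u ⊗ₜ[k] 𝓗.mul (𝓗.mul (B.1 z) w) (A.1 (𝓗.Sinv x))) ↔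
    ∀ h v, (sw (𝓗.comul h) fun a b => sw (ρ v) fun x c => act a x ⊗ₜ[k] 𝓗.mul (B.1 b) c) =
      sw (𝓗.comul h) fun a b => sw (ρ (act b v)) fun x c => x ⊗ₜ[k] 𝓗.mul c (A.1 a) := by
  constructor
  -- Substitute the formula for `ρ(h₂ · v)`; then `S⁻¹(h₂)h₁` cancels.
  · intro hc h v
    have h1 : ∀ a b, (sw (ρ (act b v)) fun x c => x ⊗ₜ[k] 𝓗.mul c (A.1 a)) =
        sw (𝓗.comul b) fun x t => sw (𝓗.comul t) fun y z => sw (ρ v) fun u w =>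
          act y u ⊗ₜ[k] 𝓗.mul (𝓗.mul (B.1 z) w) (A.1 (𝓗.mul (𝓗.Sinv x) a)) := by
      intro a b
      rw [hc, sw_apply_sw]
      refine sw_congr fun x t => ?_
      rw [sw_apply_sw]
      refine sw_congr fun y z => ?_
      rw [sw_apply_sw]
      refine sw_congr fun u w => ?_
      rw [sw_tmul, mul_assoc', aut_mul]
    rw [sw_congr h1, ← sw_comul_coassoc h (f := fun a x t => sw (𝓗.comul t) fun y z =>
      sw (ρ v) fun u w => act y u ⊗ₜ[k] 𝓗.mul (𝓗.mul (B.1 z) w) (A.1 (𝓗.mul (𝓗.Sinv x) a)))]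
    have h2 : ∀ a t, (sw (𝓗.comul a) fun a x => sw (𝓗.comul t) fun y z => sw (ρ v) fun u w =>
        act y u ⊗ₜ[k] 𝓗.mul (𝓗.mul (B.1 z) w) (A.1 (𝓗.mul (𝓗.Sinv x) a))) = 𝓗.ε a •
          sw (𝓗.comul t) fun y z => sw (ρ v) fun u w => act y u ⊗ₜ[k] 𝓗.mul (B.1 z) w := by
      intro a t
      rw [𝓗.sw_Sinv_left a (f := fun s => sw (𝓗.comul t) fun y z => sw (ρ v) fun u w =>
        act y u ⊗ₜ[k] 𝓗.mul (𝓗.mul (B.1 z) w) (A.1 s))]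
      simp only [aut_one, mul_one']
    rw [sw_congr h2, sw_counit_left h (f := fun t => sw (𝓗.comul t) fun y z => sw (ρ v) fun u w =>
      act y u ⊗ₜ[k] 𝓗.mul (B.1 z) w)]
  -- Apply the condition to `h₂ · v` and multiply by `A(S⁻¹(h₁))`; then `h₂S⁻¹(h₁)` cancels.
  · intro hc h v
    symm
    calc _ = sw (𝓗.comul h) fun x t => sw (𝓗.comul t) fun y z => sw (ρ (act z v)) fun u w =>
            u ⊗ₜ[k] 𝓗.mul (𝓗.mul w (A.1 y)) (A.1 (𝓗.Sinv x)) := by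
          refine sw_congr fun x t => ?_
          have e := congrArg
            (TensorProduct.map LinearMap.id (𝓗.mul.flip (A.1 (𝓗.Sinv x)))) (hc t v)
          simpa only [map_sw, TensorProduct.map_tmul, LinearMap.id_apply, LinearMap.flip_apply]
            using e
      _ = sw (𝓗.comul h) fun y z => sw (𝓗.comul y) fun x y => sw (ρ (act z v)) fun u w =>
            u ⊗ₜ[k] 𝓗.mul w (A.1 (𝓗.mul y (𝓗.Sinv x))) := by
          simp only [mul_assoc', aut_mul]
          exact (sw_comul_coassoc h).symm
      _ = sw (𝓗.comul h) fun y z => 𝓗.ε y • ρ (act z v) := by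
          refine sw_congr fun y z => ?_
          rw [𝓗.sw_Sinv_right y (f := fun s => sw (ρ (act z v)) fun u w =>
            u ⊗ₜ[k] 𝓗.mul w (A.1 s))]
          simp only [aut_one, mul_one', sw_tmul_self]
      _ = ρ (act h v) := sw_counit_left h (f := fun z => ρ (act z v))

namespace PreYD

variable {𝓗 : MonoidalHomHopfAlgebraBij k H} (M : PreYD 𝓗)

/-- The untwisted action `μ⁻¹(h · v)`. -/
noncomputable def uact : H →ₗ[k] M.V →ₗ[k] M.V := M.act.compr₂ M.μ.symm.toLinearMap

/-- The untwisted coaction `ρ(μ(v))`. -/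
noncomputable def ucoact : M.V →ₗ[k] M.V ⊗[k] H := M.ρ ∘ₗ M.μ.toLinearMap

theorem act_eq (h : H) (v : M.V) : M.act h v = M.μ (M.uact h v) := by simp [uact]

theorem ρ_eq (v : M.V) : M.ρ v = M.ucoact (M.μ.symm v) := by simp [ucoact]

variable {M}

theorem compat_apply (h : H) (t : M.V ⊗[k] H) :
    M.compat (TensorProduct.map LinearMap.id 𝓗.Δ (𝓗.Δ h)) t =
      sw (𝓗.Δ h) fun x s => sw (𝓗.Δ s) fun y z => sw t fun u w => M.act (𝓗.α y) u ⊗ₜ[k]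
        𝓗.m (𝓗.m (M.deg.snd.1 z) (𝓗.α.symm w)) (M.deg.fst.1 (𝓗.Sinv x)) := by
  have e := apply_eq_sw (M.compat.flip t ∘ₗ TensorProduct.map LinearMap.id 𝓗.Δ) (𝓗.Δ h)
  simp only [LinearMap.comp_apply, LinearMap.flip_apply, TensorProduct.map_tmul,
    LinearMap.id_apply] at e
  rw [e]
  refine sw_congr fun x s => ?_
  have e' := apply_eq_sw (M.compat.flip t ∘ₗ TensorProduct.mk k H (H ⊗[k] H) x) (𝓗.Δ s)
  simp only [LinearMap.comp_apply, LinearMap.flip_apply, TensorProduct.mk_apply] at e'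
  rw [e']
  refine sw_congr fun y z => ?_
  rw [apply_eq_sw (M.compat _)]
  exact sw_congr fun u w => compat_tmul ..

/-- A Yetter-Drinfeld Hom-module is the same as an ordinary Yetter-Drinfeld module with an
automorphism, by untwisting the action and the coaction. -/
theorem isYD_iff : M.IsYD ↔ IsUYD 𝓗.toMonoidalHomHopfAlgebra M.deg.fst M.deg.snd M.μ
    M.uact M.ucoact := by
  have hμ : (∀ (a : H) (v : M.V), M.μ (M.act a v) = M.act (𝓗.α a) (M.μ v)) ↔
      ∀ a v, M.μ (M.uact a v) = M.uact (𝓗.α a) (M.μ v) := by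
    simp only [act_eq, EmbeddingLike.apply_eq_iff_eq]
  have hρ : (∀ v, M.ρ (M.μ v) = TensorProduct.map M.μ.toLinearMap 𝓗.α.toLinearMap (M.ρ v)) ↔
      ∀ v, M.ucoact (M.μ v) =
        TensorProduct.map M.μ.toLinearMap 𝓗.α.toLinearMap (M.ucoact v) :=
    ⟨fun h v => h (M.μ v), fun h v => by simpa [ucoact] using h (M.μ.symm v)⟩
  have hsw : (∀ v, M.ucoact (M.μ v) =
        TensorProduct.map M.μ.toLinearMap 𝓗.α.toLinearMap (M.ucoact v)) →
      ∀ v, M.ρ v = TensorProduct.map M.μ.symm.toLinearMap 𝓗.α.symm.toLinearMap (M.ucoact v) := by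
    intro h v
    have e := h (M.μ.symm v)
    rw [LinearEquiv.apply_symm_apply] at e
    rw [e, ρ_eq, ← LinearMap.comp_apply, ← TensorProduct.map_comp]
    simp
  have hcoassoc : (∀ v, M.ucoact (M.μ v) =
        TensorProduct.map M.μ.toLinearMap 𝓗.α.toLinearMap (M.ucoact v)) →
      ((∀ v, TensorProduct.map M.μ.symm.toLinearMap 𝓗.Δ (M.ρ v) =
        TensorProduct.assoc k M.V H H (TensorProduct.map M.ρ 𝓗.α.symm.toLinearMap (M.ρ v))) ↔
      ∀ v, (sw (M.ucoact v) fun x a => sw (M.ucoact x) fun y b => y ⊗ₜ[k] (b ⊗ₜ[k] a)) =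
        sw (M.ucoact v) fun x a => sw (𝓗.comul a) fun b c => x ⊗ₜ[k] (b ⊗ₜ[k] c)) := by
    intro h
    have hv : ∀ v, M.ρ (M.μ (M.μ v)) =
        TensorProduct.map M.μ.toLinearMap 𝓗.α.toLinearMap (M.ucoact v) := h
    have hl : ∀ v, TensorProduct.map M.μ.symm.toLinearMap 𝓗.Δ (M.ρ (M.μ (M.μ v))) =
        sw (M.ucoact v) fun x a => sw (𝓗.comul a) fun b c => x ⊗ₜ[k] (b ⊗ₜ[k] c) := fun v => by
      rw [hv, ← LinearMap.comp_apply, ← TensorProduct.map_comp, apply_eq_sw (TensorProduct.map _ _)]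
      refine sw_congr fun x a => ?_
      rw [← sw_tmul_left, sw_tmul_self]
      simp [comul]
    have hr : ∀ v, TensorProduct.assoc k M.V H H
        (TensorProduct.map M.ρ 𝓗.α.symm.toLinearMap (M.ρ (M.μ (M.μ v)))) =
        sw (M.ucoact v) fun x a => sw (M.ucoact x) fun y b => y ⊗ₜ[k] (b ⊗ₜ[k] a) := fun v => by
      rw [hv, ← LinearMap.comp_apply (TensorProduct.map _ _), ← TensorProduct.map_comp,
        apply_eq_sw (TensorProduct.map _ _), map_sw]
      refine sw_congr fun x a => ?_
      have e : M.ρ (M.μ x) = sw (M.ucoact x) fun y b => y ⊗ₜ[k] b := (sw_tmul_self _).symm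
      simp [e, sw_tmul_right, map_sw]
    constructor
    · intro H v
      rw [← hl, ← hr, H]
    · intro H v
      obtain ⟨v, rfl⟩ := M.μ.surjective v
      obtain ⟨v, rfl⟩ := M.μ.surjective v
      rw [hl, hr, H]
  have hcompat : (∀ a v, M.μ (M.uact a v) = M.uact (𝓗.α a) (M.μ v)) → (∀ v, M.ucoact (M.μ v) =
        TensorProduct.map M.μ.toLinearMap 𝓗.α.toLinearMap (M.ucoact v)) →
      ∀ h v, (M.ρ (M.act h v) = M.compat (TensorProduct.map LinearMap.id 𝓗.Δ (𝓗.Δ h)) (M.ρ v) ↔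
      M.ucoact (M.uact h v) = sw (𝓗.comul h) fun x t => sw (𝓗.comul t) fun y z =>
        sw (M.ucoact v) fun u w =>
          M.uact y u ⊗ₜ[k] 𝓗.mul (𝓗.mul (M.deg.snd.1 z) w) (M.deg.fst.1 (𝓗.Sinv x))) := by
    intro h1 h2 h v
    have hl : M.ρ (M.act h v) = M.ucoact (M.uact h v) := by simp [act_eq, ρ_eq]
    have hμ' : ∀ y u, M.act (𝓗.α (𝓗.α.symm (𝓗.α.symm y))) (M.μ.symm u) = M.uact y u := by
      intro y u
      rw [act_eq, h1]
      simp
    have hm : ∀ x z w, 𝓗.m (𝓗.m (M.deg.snd.1 (𝓗.α.symm (𝓗.α.symm z)))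
        (𝓗.α.symm (𝓗.α.symm w))) (M.deg.fst.1 (𝓗.Sinv (𝓗.α.symm x))) =
        𝓗.mul (𝓗.mul (M.deg.snd.1 z) w) (M.deg.fst.1 (𝓗.Sinv x)) := by
      intro x z w
      simp only [m_eq, α_mul', aut_α_symm, 𝓗.Sinv_α_symm, LinearEquiv.apply_symm_apply]
    rw [hl, compat_apply, sw_Δ]
    simp only [hsw h2 v]
    have e : ∀ x t : H, (sw (𝓗.Δ (𝓗.α.symm t)) fun y z =>
        sw (TensorProduct.map M.μ.symm.toLinearMap 𝓗.α.symm.toLinearMap (M.ucoact v)) fun u w =>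
          M.act (𝓗.α y) u ⊗ₜ[k] 𝓗.m (𝓗.m (M.deg.snd.1 z) (𝓗.α.symm w))
            (M.deg.fst.1 (𝓗.Sinv (𝓗.α.symm x)))) =
        sw (𝓗.comul t) fun y z => sw (M.ucoact v) fun u w =>
          M.uact y u ⊗ₜ[k] 𝓗.mul (𝓗.mul (M.deg.snd.1 z) w) (M.deg.fst.1 (𝓗.Sinv x)) := by
      intro x t
      have ht : 𝓗.α.symm t = 𝓗.αAut⁻¹.1 t := rfl
      rw [ht, sw_Δ_aut, sw_Δ]
      refine sw_congr fun y z => ?_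
      rw [sw_map]
      exact sw_congr fun u w => congrArg₂ (· ⊗ₜ[k] ·) (hμ' y u) (hm x z w)
    rw [sw_congr e]
  constructor
  · intro hM
    have h1 := hμ.1 hM.μ_act
    have h2 := hρ.1 hM.ρ_μ
    refine ⟨fun a b v => ?_, fun v => ?_, h1, (hcoassoc h2).1 hM.coassoc, h2, fun v => ?_,
      compat_iff.1 fun h v => (hcompat h1 h2 h v).1 (hM.compatibility h v)⟩
    · apply M.μ.injective
      apply M.μ.injective
      simpa only [act_eq, m_eq, ← h1] using (hM.act_act a b v).symm
    · simp [uact, hM.one_act]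
    · have e := hM.counit (M.μ v)
      rw [apply_eq_sw (TensorProduct.map _ _), map_sw] at e
      simpa [ucoact] using e
  · intro hM
    have h1 := hμ.2 hM.μ_act
    have h2 := hρ.2 hM.ρ_μ
    refine ⟨fun a b v => ?_, h1, fun v => ?_, (hcoassoc hM.ρ_μ).2 hM.coassoc, h2, fun v => ?_,
      fun h v => (hcompat hM.μ_act hM.ρ_μ h v).2 (compat_iff.2 hM.compat h v)⟩
    · simp only [act_eq, m_eq, hM.μ_act, α_mul', hM.mul_act]
    · simp [act_eq, hM.one_act]
    · rw [ρ_eq, apply_eq_sw (TensorProduct.map _ _), map_sw]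
      simpa using hM.counit (M.μ.symm v)

end PreYD

end UntwistedModules

/-! ### Operations on untwisted Yetter-Drinfeld modules -/

section UntwistedOperations

variable {k H : Type u} [Field k] [AddCommGroup H] [Module k H]

open MonoidalHomHopfAlgebra

/-- The action `h · (v ⊗ w) = h₁ · v ⊗ h₂ · w`. -/
noncomputable def tensorAct {V W : Type u} [AddCommGroup V] [Module k V] [AddCommGroup W]
    [Module k W] (Δ : H →ₗ[k] H ⊗[k] H) (a₁ : H →ₗ[k] V →ₗ[k] V) (a₂ : H →ₗ[k] W →ₗ[k] W) :
    H →ₗ[k] V ⊗[k] W →ₗ[k] V ⊗[k] W :=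
  TensorProduct.homTensorHomMap (RingHom.id k) V W V W ∘ₗ TensorProduct.map a₁ a₂ ∘ₗ Δ

/-- The coaction `v ⊗ w ↦ (v₀ ⊗ w₀) ⊗ w₁v₁`. -/
noncomputable def tensorCoact {V W : Type u} [AddCommGroup V] [Module k V] [AddCommGroup W]
    [Module k W] (m : H →ₗ[k] H →ₗ[k] H) (ρ₁ : V →ₗ[k] V ⊗[k] H) (ρ₂ : W →ₗ[k] W ⊗[k] H) :
    V ⊗[k] W →ₗ[k] (V ⊗[k] W) ⊗[k] H :=
  TensorProduct.map LinearMap.id (TensorProduct.lift m.flip) ∘ₗ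
    (TensorProduct.tensorTensorTensorComm k V H W H).toLinearMap ∘ₗ TensorProduct.map ρ₁ ρ₂

section

variable {V W : Type u} [AddCommGroup V] [Module k V] [AddCommGroup W] [Module k W]
  {X : Type*} [AddCommGroup X] [Module k X]

theorem tensorAct_tmul (Δ : H →ₗ[k] H ⊗[k] H) (a₁ : H →ₗ[k] V →ₗ[k] V)
    (a₂ : H →ₗ[k] W →ₗ[k] W) (h : H) (v : V) (w : W) :
    tensorAct Δ a₁ a₂ h (v ⊗ₜ w) = sw (Δ h) fun a b => a₁ a v ⊗ₜ[k] a₂ b w := by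
  have e := apply_eq_sw ((TensorProduct.homTensorHomMap (RingHom.id k) V W V W ∘ₗ
    TensorProduct.map a₁ a₂).flip (v ⊗ₜ w)) (Δ h)
  exact e

theorem tensorCoact_tmul (m : H →ₗ[k] H →ₗ[k] H) (ρ₁ : V →ₗ[k] V ⊗[k] H) (ρ₂ : W →ₗ[k] W ⊗[k] H)
    (v : V) (w : W) : tensorCoact m ρ₁ ρ₂ (v ⊗ₜ w) =
      sw (ρ₁ v) fun x a => sw (ρ₂ w) fun y b => (x ⊗ₜ[k] y) ⊗ₜ[k] m b a := by
  conv_lhs => rw [tensorCoact, LinearMap.comp_apply, LinearMap.comp_apply, TensorProduct.map_tmul,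
    ← sw_tmul_self (ρ₁ v), ← sw_tmul_self (ρ₂ w)]
  rw [sw_tmul_right]
  simp only [sw_tmul_left, map_sw]
  rfl

theorem sw_tensorCoact_tmul (m : H →ₗ[k] H →ₗ[k] H) (ρ₁ : V →ₗ[k] V ⊗[k] H)
    (ρ₂ : W →ₗ[k] W ⊗[k] H) (v : V) (w : W) {f : V ⊗[k] W → H → X}
    (hf : IsBilin k f := by simp) : sw (tensorCoact m ρ₁ ρ₂ (v ⊗ₜ w)) f =
      sw (ρ₁ v) fun x a => sw (ρ₂ w) fun y b => f (x ⊗ₜ[k] y) (m b a) := by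
  rw [tensorCoact_tmul, sw_apply_sw _ _ hf]
  refine sw_congr fun x a => ?_
  rw [sw_apply_sw _ _ hf]
  exact sw_congr fun y b => sw_tmul _ _ hf

end

namespace IsUYD

variable {𝓗 : MonoidalHomHopfAlgebra k H} {A B C D : AutMHH 𝓗} {V W : Type u} [AddCommGroup V]
  [Module k V] [AddCommGroup W] [Module k W] {μ : V ≃ₗ[k] V} {act : H →ₗ[k] V →ₗ[k] V}
  {ρ : V →ₗ[k] V ⊗[k] H} {ν : W ≃ₗ[k] W} {act' : H →ₗ[k] W →ₗ[k] W} {ρ' : W →ₗ[k] W ⊗[k] H}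
  {X : Type*} [AddCommGroup X] [Module k X]

/-- Twisting the action by an automorphism `E` and the coaction by an automorphism `G` turns an
`(A, B)`-Yetter-Drinfeld module into a `(GAE, GBE)`-Yetter-Drinfeld module. -/
theorem twist (M : IsUYD 𝓗 A B μ act ρ) (E G : AutMHH 𝓗) :
    IsUYD 𝓗 (G * A * E) (G * B * E) μ (act ∘ₗ E.1.toLinearMap)
      (TensorProduct.map LinearMap.id G.1.toLinearMap ∘ₗ ρ) where
  mul_act a b v := by simp [aut_mul, M.mul_act]
  one_act v := by simp [aut_one, M.one_act]
  μ_act a v := by simp [aut_α, M.μ_act]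
  coassoc v := by
    simp only [LinearMap.comp_apply]
    rw [sw_map, sw_map]
    simp only [LinearMap.id_apply, LinearEquiv.coe_coe]
    have h1 : ∀ x a, (sw (TensorProduct.map LinearMap.id G.1.toLinearMap (ρ x)) fun y b =>
        y ⊗ₜ[k] (b ⊗ₜ[k] G.1 a)) = sw (ρ x) fun y b => y ⊗ₜ[k] (G.1 b ⊗ₜ[k] G.1 a) :=
      fun x a => by rw [sw_map]; rfl
    rw [sw_congr h1, M.sw_coassoc v (f := fun y b a => y ⊗ₜ[k] (G.1 b ⊗ₜ[k] G.1 a))]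
    refine sw_congr fun x a => ?_
    rw [sw_comul_aut]
  ρ_μ v := by
    simp only [LinearMap.comp_apply, M.ρ_μ]
    rw [TensorProduct.map_map, TensorProduct.map_map]
    have e : G.1.toLinearMap ∘ₗ 𝓗.α.toLinearMap = 𝓗.α.toLinearMap ∘ₗ G.1.toLinearMap :=
      LinearMap.ext fun x => aut_α G x
    rw [e, LinearMap.id_comp, LinearMap.comp_id]
  counit v := by
    simp only [LinearMap.comp_apply]
    rw [sw_map _ _ _ (isBilin_smul _)]
    simp only [LinearMap.id_apply, LinearEquiv.coe_coe, aut_counit]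
    exact M.counit v
  compat h v := by
    have h0 := M.sw_compat (E.1 h) v (f := fun x c => x ⊗ₜ[k] G.1 c)
    rw [sw_comul_aut, sw_comul_aut] at h0
    have h1 : ∀ a b : H, (sw (TensorProduct.map LinearMap.id G.1.toLinearMap (ρ v)) fun x c =>
        act (E.1 a) x ⊗ₜ[k] 𝓗.mul (G.1 (B.1 (E.1 b))) c) =
        sw (ρ v) fun x c => act (E.1 a) x ⊗ₜ[k] G.1 (𝓗.mul (B.1 (E.1 b)) c) := fun a b => by
      rw [sw_map]; simp [aut_mul]
    have h2 : ∀ a b : H, (sw (TensorProduct.map LinearMap.id G.1.toLinearMap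
          (ρ (act (E.1 b) v))) fun x c => x ⊗ₜ[k] 𝓗.mul c (G.1 (A.1 (E.1 a)))) =
        sw (ρ (act (E.1 b) v)) fun x c => x ⊗ₜ[k] G.1 (𝓗.mul c (A.1 (E.1 a))) := fun a b => by
      rw [sw_map]; simp [aut_mul]
    exact (sw_congr h1).trans (h0.trans (sw_congr h2).symm)

/-- The tensor product of an `(A, B)`- and a `(C, D)`-Yetter-Drinfeld module. With `E = C⁻¹BC`, the
compatibility follows from that of the second factor at `E(h)`, then that of the first factor at
`C(h)`; they fit together because `CE = BC`. -/
theorem tensor (M : IsUYD 𝓗 A B μ act ρ) (N : IsUYD 𝓗 C D ν act' ρ') :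
    IsUYD 𝓗 (A * C) (D * C⁻¹ * B * C) (TensorProduct.congr μ ν)
      (tensorAct 𝓗.comul (act ∘ₗ C.1.toLinearMap) (act' ∘ₗ (C⁻¹ * B * C).1.toLinearMap))
      (tensorCoact 𝓗.mul ρ ρ') where
  mul_act a b t := by
    induction t with
    | zero => simp
    | add x y hx hy => simp only [map_add, hx, hy]
    | tmul v w =>
      rw [tensorAct_tmul, tensorAct_tmul, sw_comul_mul, map_sw]
      simp only [tensorAct_tmul]
      rw [sw_comm]
      simp only [LinearMap.comp_apply, LinearEquiv.coe_coe, aut_mul, M.mul_act, N.mul_act]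
  one_act t := by
    induction t with
    | zero => simp
    | add x y hx hy => simp only [map_add, hx, hy]
    | tmul v w =>
      rw [tensorAct_tmul, sw_comul_one]
      simp only [LinearMap.comp_apply, LinearEquiv.coe_coe, aut_one, M.one_act, N.one_act]
  μ_act a t := by
    induction t with
    | zero => simp
    | add x y hx hy => simp only [map_add, hx, hy]
    | tmul v w =>
      have ha : 𝓗.α a = 𝓗.αAut.1 a := rfl
      rw [TensorProduct.congr_tmul, tensorAct_tmul, tensorAct_tmul, ha, sw_comul_aut, map_sw]
      refine sw_congr fun x y => ?_
      rw [TensorProduct.congr_tmul]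
      simp only [LinearMap.comp_apply, LinearEquiv.coe_coe, M.μ_act, N.μ_act, ← aut_α]
      rfl
  coassoc t := by
    induction t with
    | zero => simp
    | add x y hx hy => simp_all
    | tmul v w =>
      have hN : ∀ (x : V) (p q : H), (sw (ρ' w) fun y b => sw (ρ' y) fun y' b' =>
          (x ⊗ₜ[k] y') ⊗ₜ[k] (𝓗.mul b' p ⊗ₜ[k] 𝓗.mul b q)) =
          sw (ρ' w) fun y b => sw (𝓗.comul b) fun r s =>
            (x ⊗ₜ[k] y) ⊗ₜ[k] (𝓗.mul r p ⊗ₜ[k] 𝓗.mul s q) := fun x p q =>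
        N.sw_coassoc w (f := fun y b' b =>
          (x ⊗ₜ[k] y) ⊗ₜ[k] (𝓗.mul b' p ⊗ₜ[k] 𝓗.mul b q))
      calc _ = sw (ρ v) fun x a => sw (ρ' w) fun y b => sw (ρ x) fun x' a' => sw (ρ' y) fun y' b' =>
            (x' ⊗ₜ[k] y') ⊗ₜ[k] (𝓗.mul b' a' ⊗ₜ[k] 𝓗.mul b a) := by
            rw [sw_tensorCoact_tmul]
            refine sw_congr fun x a => sw_congr fun y b => ?_
            rw [sw_tensorCoact_tmul]
        _ = sw (ρ v) fun x a => sw (ρ x) fun x' a' => sw (ρ' w) fun y b => sw (ρ' y) fun y' b' =>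
            (x' ⊗ₜ[k] y') ⊗ₜ[k] (𝓗.mul b' a' ⊗ₜ[k] 𝓗.mul b a) :=
            sw_congr fun x a => sw_comm _ _ _
        _ = sw (ρ v) fun x a => sw (ρ x) fun x' a' => sw (ρ' w) fun y b => sw (𝓗.comul b) fun r s =>
            (x' ⊗ₜ[k] y) ⊗ₜ[k] (𝓗.mul r a' ⊗ₜ[k] 𝓗.mul s a) :=
            sw_congr fun x a => sw_congr fun x' a' => hN x' a' a
        _ = sw (ρ v) fun x a => sw (𝓗.comul a) fun p q => sw (ρ' w) fun y b =>
            sw (𝓗.comul b) fun r s =>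
              (x ⊗ₜ[k] y) ⊗ₜ[k] (𝓗.mul r p ⊗ₜ[k] 𝓗.mul s q) := M.sw_coassoc v
        _ = _ := by
            rw [sw_tensorCoact_tmul]
            refine sw_congr fun x a => ?_
            rw [sw_comm]
            refine sw_congr fun y b => ?_
            rw [sw_comul_mul, sw_comm]
  ρ_μ t := by
    induction t with
    | zero => simp
    | add x y hx hy => simp only [map_add, hx, hy]
    | tmul v w =>
      rw [TensorProduct.congr_tmul, tensorCoact_tmul, tensorCoact_tmul, map_sw, M.sw_μ]
      refine sw_congr fun x a => ?_
      rw [N.sw_μ, map_sw]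
      refine sw_congr fun y b => ?_
      simp [α_mul']
  counit t := by
    induction t with
    | zero => rw [map_zero, sw_zero (isBilin_smul _)]
    | add x y hx hy => rw [map_add, sw_add (isBilin_smul _), hx, hy]
    | tmul v w =>
      rw [sw_tensorCoact_tmul _ _ _ _ _ (isBilin_smul _)]
      have h1 : ∀ (x : V) (a : H), (sw (ρ' w) fun y b => 𝓗.ε (𝓗.mul b a) • x ⊗ₜ[k] y) =
          𝓗.ε a • x ⊗ₜ[k] w := fun x a => by
        rw [← N.sw_counit w (f := fun y => 𝓗.ε a • x ⊗ₜ[k] y)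
          (by simp [smul_comm _ (𝓗.ε a)])]
        refine sw_congr fun y b => ?_
        rw [counit_mul', mul_smul]
      rw [sw_congr h1, M.sw_counit v (f := fun x => x ⊗ₜ[k] w)]
  compat h t := by
    induction t with
    | zero => simp
    | add x y hx hy => simp_all
    | tmul v w =>
      set E := C⁻¹ * B * C with hE
      have hD : D * C⁻¹ * B * C = D * E := by rw [hE]; group
      have hC : ∀ a, C.1 (E.1 a) = B.1 (C.1 a) := fun a => by
        rw [← aut_mul_apply, hE, ← aut_mul_apply]; group
      rw [hD]
      have h1 : ∀ a b : H, (sw (ρ v) fun x c => sw (𝓗.comul b) fun p q => sw (ρ' w) fun y d =>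
          (act (C.1 a) x ⊗ₜ[k] act' (E.1 p) y) ⊗ₜ[k] 𝓗.mul (D.1 (E.1 q)) (𝓗.mul d c)) =
          sw (𝓗.comul b) fun p q => sw (ρ v) fun x c => sw (ρ' (act' (E.1 q) w)) fun y d =>
          (act (C.1 a) x ⊗ₜ[k] y) ⊗ₜ[k] 𝓗.mul (𝓗.mul d (B.1 (C.1 p))) c := by
        intro a b
        rw [← sw_comm (ρ v)]
        refine sw_congr fun x c => ?_
        have e := N.sw_compat (E.1 b) w
          (f := fun y d => (act (C.1 a) x ⊗ₜ[k] y) ⊗ₜ[k] 𝓗.mul d c)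
        rw [sw_comul_aut, sw_comul_aut] at e
        simpa only [mul_assoc', hC] using e
      have h2 : ∀ b q : H, (sw (𝓗.comul b) fun a p => sw (ρ v) fun x c =>
          sw (ρ' (act' (E.1 q) w)) fun y d =>
            (act (C.1 a) x ⊗ₜ[k] y) ⊗ₜ[k] 𝓗.mul d (𝓗.mul (B.1 (C.1 p)) c)) =
          sw (𝓗.comul b) fun a p => sw (ρ (act (C.1 p) v)) fun x c =>
            sw (ρ' (act' (E.1 q) w)) fun y d =>
              (x ⊗ₜ[k] y) ⊗ₜ[k] 𝓗.mul d (𝓗.mul c (A.1 (C.1 a))) := by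
        intro b q
        have e := M.sw_compat (C.1 b) v (f := fun x c => sw (ρ' (act' (E.1 q) w)) fun y d =>
          (x ⊗ₜ[k] y) ⊗ₜ[k] 𝓗.mul d c)
        rwa [sw_comul_aut, sw_comul_aut] at e
      calc _ = sw (𝓗.comul h) fun a b => sw (𝓗.comul a) fun p q => sw (ρ v) fun x c =>
            sw (ρ' w) fun y d => (act (C.1 p) x ⊗ₜ[k] act' (E.1 q) y) ⊗ₜ[k]
              𝓗.mul (D.1 (E.1 b)) (𝓗.mul d c) := by
            refine sw_congr fun a b => ?_
            rw [sw_tensorCoact_tmul, sw_comm (𝓗.comul a) (ρ v)]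
            refine sw_congr fun x c => ?_
            rw [sw_comm (𝓗.comul a) (ρ' w)]
            refine sw_congr fun y d => ?_
            rw [tensorAct_tmul, sw_tmul_right]
            rfl
        _ = sw (𝓗.comul h) fun a b => sw (𝓗.comul b) fun p q => sw (ρ v) fun x c =>
            sw (ρ' w) fun y d => (act (C.1 a) x ⊗ₜ[k] act' (E.1 p) y) ⊗ₜ[k]
              𝓗.mul (D.1 (E.1 q)) (𝓗.mul d c) := sw_comul_coassoc h
        _ = sw (𝓗.comul h) fun a b => sw (𝓗.comul b) fun p q => sw (ρ v) fun x c =>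
            sw (ρ' (act' (E.1 q) w)) fun y d =>
              (act (C.1 a) x ⊗ₜ[k] y) ⊗ₜ[k] 𝓗.mul d (𝓗.mul (B.1 (C.1 p)) c) := by
            refine sw_congr fun a b => ?_
            rw [sw_comm, h1]
            simp only [mul_assoc']
        _ = sw (𝓗.comul h) fun b q => sw (𝓗.comul b) fun a p => sw (ρ v) fun x c =>
            sw (ρ' (act' (E.1 q) w)) fun y d =>
              (act (C.1 a) x ⊗ₜ[k] y) ⊗ₜ[k] 𝓗.mul d (𝓗.mul (B.1 (C.1 p)) c) :=
            (sw_comul_coassoc h).symm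
        _ = sw (𝓗.comul h) fun b q => sw (𝓗.comul b) fun a p => sw (ρ (act (C.1 p) v)) fun x c =>
            sw (ρ' (act' (E.1 q) w)) fun y d =>
              (x ⊗ₜ[k] y) ⊗ₜ[k] 𝓗.mul d (𝓗.mul c (A.1 (C.1 a))) := sw_congr h2
        _ = sw (𝓗.comul h) fun a b => sw (𝓗.comul b) fun p q => sw (ρ (act (C.1 p) v)) fun x c =>
            sw (ρ' (act' (E.1 q) w)) fun y d =>
              (x ⊗ₜ[k] y) ⊗ₜ[k] 𝓗.mul d (𝓗.mul c (A.1 (C.1 a))) := sw_comul_coassoc h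
        _ = _ := by
            refine sw_congr fun a b => ?_
            rw [tensorAct_tmul, map_sw, sw_apply_sw]
            refine sw_congr fun p q => ?_
            rw [sw_tensorCoact_tmul]
            simp only [mul_assoc']
            rfl

variable (𝓗) in
/-- The Yetter-Drinfeld module with action `h · v = ε(h)v` and coaction `v ↦ v ⊗ 1`. -/
theorem trivial : IsUYD 𝓗 1 1 (LinearEquiv.refl k V) (LinearMap.lsmul k V ∘ₗ 𝓗.ε)
    ((TensorProduct.mk k V H).flip 𝓗.one) where
  mul_act a b v := by simp [counit_mul', mul_smul, smul_comm (𝓗.ε a)]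
  one_act v := by simp [𝓗.counit_one]
  μ_act a v := by simp [𝓗.counit_α]
  coassoc v := by
    simp only [LinearMap.flip_apply, TensorProduct.mk_apply]
    rw [sw_tmul, sw_tmul, sw_tmul, sw_comul_one]
  ρ_μ v := by simp [𝓗.α_one]
  counit v := by
    rw [LinearMap.flip_apply, TensorProduct.mk_apply, sw_tmul _ _ (isBilin_smul _), 𝓗.counit_one,
      one_smul]
  compat h v := by
    have h1 : ∀ a b : H, (sw ((TensorProduct.mk k V H).flip 𝓗.one v) fun x c =>
        (LinearMap.lsmul k V ∘ₗ 𝓗.ε) a x ⊗ₜ[k] 𝓗.mul b c) = 𝓗.ε a • v ⊗ₜ[k] b := fun a b => by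
      rw [LinearMap.flip_apply, TensorProduct.mk_apply,
        sw_tmul _ _ (by simp [smul_comm (𝓗.ε a)]), mul_one']; rfl
    have h2 : ∀ a b : H, (sw ((TensorProduct.mk k V H).flip 𝓗.one
        ((LinearMap.lsmul k V ∘ₗ 𝓗.ε) b v)) fun x c => x ⊗ₜ[k] 𝓗.mul c a) =
          𝓗.ε b • v ⊗ₜ[k] a := fun a b => by
      rw [LinearMap.flip_apply, TensorProduct.mk_apply, sw_tmul, one_mul']; rfl
    refine (sw_congr h1).trans (Eq.trans ?_ (sw_congr h2).symm)
    rw [sw_counit_left h (f := fun b => v ⊗ₜ[k] b), sw_counit_right h (f := fun b => v ⊗ₜ[k] b)]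

end IsUYD

end UntwistedOperations

/-! ### The tensor product, conjugates and constraints -/

section Closed

variable {k H : Type u} [Field k] [AddCommGroup H] [Module k H]

open MonoidalHomHopfAlgebra

theorem TwistedPair.fst_mul {Γ : Type*} [Group Γ] (p q : TwistedPair Γ) :
    (p * q).fst = p.fst * q.fst := rfl

theorem TwistedPair.snd_mul {Γ : Type*} [Group Γ] (p q : TwistedPair Γ) :
    (p * q).snd = q.snd * q.fst⁻¹ * p.snd * q.fst := rfl

theorem TwistedPair.fst_inv {Γ : Type*} [Group Γ] (p : TwistedPair Γ) :
    p⁻¹.fst = p.fst⁻¹ := rfl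

theorem TwistedPair.snd_inv {Γ : Type*} [Group Γ] (p : TwistedPair Γ) :
    p⁻¹.snd = p.fst * p.snd⁻¹ * p.fst⁻¹ := rfl

theorem TwistedPair.fst_one {Γ : Type*} [Group Γ] : (1 : TwistedPair Γ).fst = 1 := rfl

theorem TwistedPair.snd_one {Γ : Type*} [Group Γ] : (1 : TwistedPair Γ).snd = 1 := rfl

theorem TwistedPair.fst_conj {Γ : Type*} [Group Γ] (g p : TwistedPair Γ) :
    (g * p * g⁻¹).fst = g.fst * p.fst * g.fst⁻¹ := rfl

theorem TwistedPair.snd_conj {Γ : Type*} [Group Γ] (g p : TwistedPair Γ) :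
    (g * p * g⁻¹).snd =
      g.fst * g.snd⁻¹ * p.snd * (p.fst⁻¹ * g.snd * p.fst * g.fst⁻¹) := by
  simp only [snd_mul, fst_inv, snd_inv]
  group

theorem MonoidalHomHopfAlgebra.αAut_conj {𝓗 : MonoidalHomHopfAlgebra k H} (A : AutMHH 𝓗) :
    𝓗.αAut * A * 𝓗.αAut⁻¹ = A := by
  rw [αAut_mul, mul_inv_cancel_right]

namespace PreYD

variable {𝓗 : MonoidalHomHopfAlgebraBij k H}

/-- Untwisting the tensor product of Hom-modules gives the ordinary tensor product, up to a twist
by `α⁻¹` in the action and, in `ucoact_tensor`, by `α` in the coaction. -/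
theorem uact_tensor (M N : PreYD 𝓗) : (M.tensor N).uact =
    tensorAct 𝓗.comul (M.uact ∘ₗ N.deg.fst.1.toLinearMap)
      (N.uact ∘ₗ (N.deg.fst⁻¹ * M.deg.snd * N.deg.fst).1.toLinearMap) ∘ₗ
        𝓗.αAut⁻¹.1.toLinearMap := by
  refine LinearMap.ext fun h => TensorProduct.ext' fun v w => ?_
  rw [LinearMap.comp_apply, tensorAct_tmul]
  change (TensorProduct.congr M.μ N.μ).symm (tensorAct 𝓗.Δ _ _ h (v ⊗ₜ w)) = _
  rw [tensorAct_tmul, map_sw, Δ_eq]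
  rfl

theorem ucoact_tensor (M N : PreYD 𝓗) : (M.tensor N).ucoact =
    TensorProduct.map LinearMap.id 𝓗.αAut.1.toLinearMap ∘ₗ
      tensorCoact 𝓗.mul M.ucoact N.ucoact := by
  refine TensorProduct.ext' fun v w => ?_
  change tensorCoact 𝓗.m M.ρ N.ρ (M.μ v ⊗ₜ N.μ w) = _
  rw [LinearMap.comp_apply, tensorCoact_tmul, tensorCoact_tmul, map_sw]
  refine sw_congr fun x a => ?_
  rw [map_sw]
  refine sw_congr fun y b => ?_
  rw [m_eq]
  rfl

theorem uact_tensor_tmul (M N : PreYD 𝓗) (h : H) (v : M.V) (w : N.V) :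
    (M.tensor N).uact h (v ⊗ₜ w) = sw (𝓗.comul (𝓗.αAut⁻¹.1 h)) fun a b =>
      M.uact (N.deg.fst.1 a) v ⊗ₜ[k] N.uact (N.deg.fst⁻¹.1 (M.deg.snd.1 (N.deg.fst.1 b))) w := by
  rw [uact_tensor, LinearMap.comp_apply, tensorAct_tmul]
  rfl

theorem sw_ucoact_tensor_tmul {X : Type*} [AddCommGroup X] [Module k X] (M N : PreYD 𝓗)
    (v : M.V) (w : N.V) {f : M.V ⊗[k] N.V → H → X} (hf : IsBilin k f := by simp) :
    sw ((M.tensor N).ucoact (v ⊗ₜ w)) f = sw (M.ucoact v) fun x a => sw (N.ucoact w) fun y b =>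
      f (x ⊗ₜ[k] y) (𝓗.α (𝓗.mul b a)) := by
  rw [ucoact_tensor, LinearMap.comp_apply, tensorCoact_tmul, map_sw, sw_apply_sw _ _ hf]
  refine sw_congr fun x a => ?_
  rw [map_sw, sw_apply_sw _ _ hf]
  refine sw_congr fun y b => ?_
  rw [TensorProduct.map_tmul, sw_tmul _ _ hf]
  rfl

theorem ucoact_conj (g : TwistedPair (AutMHH 𝓗.toMonoidalHomHopfAlgebra)) (N : PreYD 𝓗) :
    (N.conj g).ucoact =
      TensorProduct.map LinearMap.id (g.fst * g.snd⁻¹).1.toLinearMap ∘ₗ N.ucoact := rfl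

theorem IsYD.untwist {M : PreYD 𝓗} (hM : M.IsYD) : IsUYD 𝓗.toMonoidalHomHopfAlgebra M.deg.fst
    M.deg.snd M.μ M.uact M.ucoact :=
  isYD_iff.1 hM

/-- The twists by `α⁻¹` and `α` in the untwisted tensor product leave the index unchanged, as `α`
is central. -/
theorem IsYD.tensor {M N : PreYD 𝓗} (hM : M.IsYD) (hN : N.IsYD) : (M.tensor N).IsYD := by
  have h := (hM.untwist.tensor hN.untwist).twist 𝓗.αAut⁻¹ 𝓗.αAut
  rw [αAut_conj, αAut_conj] at h
  rw [isYD_iff, uact_tensor, ucoact_tensor]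
  exact h

/-- The conjugate of a module is one of its twists. -/
theorem IsYD.conj {N : PreYD 𝓗} (hN : N.IsYD)
    (g : TwistedPair (AutMHH 𝓗.toMonoidalHomHopfAlgebra)) : (N.conj g).IsYD := by
  have h := hN.untwist.twist (N.deg.fst⁻¹ * g.snd * N.deg.fst * g.fst⁻¹) (g.fst * g.snd⁻¹)
  rw [isYD_iff]
  have h1 : (N.conj g).deg.fst = g.fst * g.snd⁻¹ * N.deg.fst *
      (N.deg.fst⁻¹ * g.snd * N.deg.fst * g.fst⁻¹) := by
    rw [TwistedPair.fst_conj]; group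
  rw [h1, TwistedPair.snd_conj]
  exact h

theorem isYD_unit : (unit 𝓗).IsYD :=
  isYD_iff.2 (IsUYD.trivial 𝓗.toMonoidalHomHopfAlgebra)

/-- Linearity and colinearity can be checked for the untwisted action and coaction. -/
theorem isHom_of_untwisted {M N : PreYD 𝓗} {f : M.V →ₗ[k] N.V} (hdeg : M.deg = N.deg)
    (hμ : ∀ v, f (M.μ v) = N.μ (f v)) (hact : ∀ h v, f (M.uact h v) = N.uact h (f v))
    (hρ : ∀ v, N.ucoact (f v) = TensorProduct.map f LinearMap.id (M.ucoact v)) : IsHom M N f where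
  deg_eq := hdeg
  map_μ := hμ
  map_act h v := by rw [act_eq, hμ, hact, act_eq]
  map_ρ v := by
    rw [ρ_eq, ρ_eq, ← hρ]
    congr 1
    rw [LinearEquiv.symm_apply_eq, ← hμ, LinearEquiv.apply_symm_apply]

theorem αAut_apply (h : H) : 𝓗.αAut.1 h = 𝓗.α h := rfl

theorem αAut_inv_apply (h : H) : 𝓗.αAut⁻¹.1 h = 𝓗.α.symm h := rfl

theorem μ_uact {M : PreYD 𝓗} (hM : M.IsYD) (h : H) (v : M.V) :
    M.μ (M.uact h v) = M.uact (𝓗.αAut.1 h) (M.μ v) := hM.untwist.μ_act h v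

theorem μ_symm_uact {M : PreYD 𝓗} (hM : M.IsYD) (h : H) (v : M.V) :
    M.μ.symm (M.uact h v) = M.uact (𝓗.αAut⁻¹.1 h) (M.μ.symm v) := by
  rw [LinearEquiv.symm_apply_eq, μ_uact hM, aut_apply_inv, LinearEquiv.apply_symm_apply]

theorem sw_ucoact_μ_symm {X : Type*} [AddCommGroup X] [Module k X] {M : PreYD 𝓗} (hM : M.IsYD)
    (v : M.V) {f : M.V → H → X} (hf : IsBilin k f := by simp) :
    sw (M.ucoact (M.μ.symm v)) f = sw (M.ucoact v) fun x a => f (M.μ.symm x) (𝓗.α.symm a) := by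
  obtain ⟨v, rfl⟩ := M.μ.surjective v
  rw [hM.untwist.ρ_μ, LinearEquiv.symm_apply_apply]
  refine Eq.trans ?_ (sw_map _ _ _ (hf.comp M.μ.symm.toLinearMap 𝓗.α.symm.toLinearMap)).symm
  simp

/-- In terms of the untwisted structure, the braiding is `v ⊗ w ↦ w₀ ⊗ B⁻¹(w₁) · v`. -/
theorem braid_tmul {M N : PreYD 𝓗} (hM : M.IsYD) (hN : N.IsYD) (v : M.V) (w : N.V) :
    braid M N (v ⊗ₜ w) =
      sw (N.ucoact w) fun x a => x ⊗ₜ[k] M.uact (M.deg.snd⁻¹.1 a) v := by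
  have e : N.ρ w = sw (N.ucoact w) fun x a => N.μ.symm x ⊗ₜ[k] 𝓗.α.symm a := by
    rw [ρ_eq, ← sw_tmul_self (N.ucoact (N.μ.symm w)), sw_ucoact_μ_symm hN]
  simp only [braid, LinearMap.comp_apply, TensorProduct.map_tmul, e, sw_tmul_left, map_sw]
  refine sw_congr fun x a => ?_
  simp only [LinearEquiv.coe_coe, TensorProduct.comm_tmul, TensorProduct.assoc_tmul,
    TensorProduct.map_tmul, TensorProduct.lift.tmul, LinearMap.comp_apply,
    LinearEquiv.apply_symm_apply, act_eq, μ_uact hM]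
  congr 2
  rw [aut_α_symm]
  simp [αAut]

theorem isHom_assoc {M N P : PreYD 𝓗} (hM : M.IsYD) (hP : P.IsYD) :
    IsHom ((M.tensor N).tensor P) (M.tensor (N.tensor P)) (assoc M N P).toLinearMap := by
  have ha : ∀ m n p, assoc M N P ((m ⊗ₜ n) ⊗ₜ p) =
    M.μ m ⊗ₜ (n ⊗ₜ P.μ.symm p) := fun _ _ _ => rfl
  refine isHom_of_untwisted (mul_assoc _ _ _) (fun t => ?_) (fun h t => ?_) (fun t => ?_)
  · refine LinearMap.congr_fun (f := (assoc M N P).toLinearMap ∘ₗ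
      ((M.tensor N).tensor P).μ.toLinearMap) (g := (M.tensor (N.tensor P)).μ.toLinearMap ∘ₗ
        (assoc M N P).toLinearMap) (TensorProduct.ext_threefold fun m n p => ?_) t
    change assoc M N P ((M.μ m ⊗ₜ N.μ n) ⊗ₜ P.μ p) =
      TensorProduct.congr M.μ (TensorProduct.congr N.μ P.μ) (assoc M N P ((m ⊗ₜ n) ⊗ₜ p))
    simp [ha]
  · refine LinearMap.congr_fun (f := (assoc M N P).toLinearMap ∘ₗ
      ((M.tensor N).tensor P).uact h) (g := (M.tensor (N.tensor P)).uact h ∘ₗ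
        (assoc M N P).toLinearMap) (TensorProduct.ext_threefold fun m n p => ?_) t
    rw [LinearMap.comp_apply, LinearMap.comp_apply, LinearEquiv.coe_coe, ha, uact_tensor_tmul,
      uact_tensor_tmul, map_sw]
    have hl : ∀ a b : H, assoc M N P (((M.tensor N).uact (P.deg.fst.1 a)) (m ⊗ₜ n) ⊗ₜ
        P.uact (P.deg.fst⁻¹.1 ((M.tensor N).deg.snd.1 (P.deg.fst.1 b))) p) =
        sw (𝓗.comul a) fun c d => M.uact (N.deg.fst.1 (P.deg.fst.1 c)) (M.μ m) ⊗ₜ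
          (N.uact (N.deg.fst⁻¹.1 (M.deg.snd.1 (N.deg.fst.1 (P.deg.fst.1 (𝓗.αAut⁻¹.1 d))))) n ⊗ₜ
          P.uact (P.deg.fst⁻¹.1 (N.deg.snd.1 (N.deg.fst⁻¹.1 (M.deg.snd.1 (N.deg.fst.1
            (P.deg.fst.1 (𝓗.αAut⁻¹.1 b))))))) (P.μ.symm p)) := by
      intro a b
      rw [uact_tensor_tmul, sw_comul_aut, sw_comul_aut, sw_tmul_right, map_sw]
      refine sw_congr fun c d => ?_
      rw [ha, μ_uact hM, μ_symm_uact hP]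
      simp only [TwistedPair.snd_mul, aut_mul_apply, αAut_apply, αAut_inv_apply, aut_α_symm,
        LinearEquiv.symm_apply_apply]
    have hr : ∀ a b : H, M.uact ((N.tensor P).deg.fst.1 a) (M.μ m) ⊗ₜ[k]
        (N.tensor P).uact ((N.tensor P).deg.fst⁻¹.1 (M.deg.snd.1 ((N.tensor P).deg.fst.1 b)))
          (n ⊗ₜ[k] P.μ.symm p) =
        sw (𝓗.comul b) fun c d => M.uact (N.deg.fst.1 (P.deg.fst.1 a)) (M.μ m) ⊗ₜ
          (N.uact (N.deg.fst⁻¹.1 (M.deg.snd.1 (N.deg.fst.1 (P.deg.fst.1 (𝓗.αAut⁻¹.1 c))))) n ⊗ₜ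
          P.uact (P.deg.fst⁻¹.1 (N.deg.snd.1 (N.deg.fst⁻¹.1 (M.deg.snd.1 (N.deg.fst.1
            (P.deg.fst.1 (𝓗.αAut⁻¹.1 d))))))) (P.μ.symm p)) := by
      intro a b
      rw [uact_tensor_tmul, sw_comul_aut, sw_comul_aut, sw_comul_aut, sw_comul_aut, sw_tmul_left]
      refine sw_congr fun c d => ?_
      simp only [TwistedPair.fst_mul, mul_inv_rev, aut_mul_apply, αAut_inv_apply, aut_α_symm,
        aut_apply_inv]
    rw [sw_congr hl, sw_congr hr]
    exact sw_comul_coassoc _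
  · refine LinearMap.congr_fun (f := (M.tensor (N.tensor P)).ucoact ∘ₗ (assoc M N P).toLinearMap)
      (g := TensorProduct.map (assoc M N P).toLinearMap LinearMap.id ∘ₗ
        ((M.tensor N).tensor P).ucoact) (TensorProduct.ext_threefold fun m n p => ?_) t
    rw [LinearMap.comp_apply, LinearMap.comp_apply, LinearEquiv.coe_coe, ha,
      apply_eq_sw (TensorProduct.map _ _),
      ← sw_tmul_self ((M.tensor (N.tensor P)).ucoact _)]
    refine (sw_ucoact_tensor_tmul M (N.tensor P) _ _).trans
      (Eq.trans ?_ (sw_ucoact_tensor_tmul (M.tensor N) P _ _).symm)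
    rw [hM.untwist.sw_μ, sw_ucoact_tensor_tmul M N]
    refine sw_congr fun x a => ?_
    rw [sw_ucoact_tensor_tmul N P]
    refine sw_congr fun y b => ?_
    rw [sw_ucoact_μ_symm hP]
    refine sw_congr fun z c => ?_
    rw [TensorProduct.map_tmul, LinearEquiv.coe_coe, ha]
    simp only [α_mul', mul_assoc', LinearMap.id_apply, LinearEquiv.apply_symm_apply]

theorem isHom_leftUnit {M : PreYD 𝓗} (hM : M.IsYD) :
    IsHom ((unit 𝓗).tensor M) M M.leftUnit.toLinearMap := by
  have ha : ∀ (x : k) (m : M.V), M.leftUnit (x ⊗ₜ m) = M.μ (x • m) := fun _ _ => rfl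
  refine isHom_of_untwisted (one_mul _) (fun t => ?_) (fun h t => ?_) (fun t => ?_)
  · refine LinearMap.congr_fun (f := M.leftUnit.toLinearMap ∘ₗ ((unit 𝓗).tensor M).μ.toLinearMap)
      (g := M.μ.toLinearMap ∘ₗ M.leftUnit.toLinearMap) (TensorProduct.ext' fun x m => ?_) t
    change M.leftUnit (x ⊗ₜ M.μ m) = M.μ (M.leftUnit (x ⊗ₜ m))
    rw [ha, ha, map_smul, map_smul, map_smul]
  · refine LinearMap.congr_fun (f := M.leftUnit.toLinearMap ∘ₗ ((unit 𝓗).tensor M).uact h)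
      (g := M.uact h ∘ₗ M.leftUnit.toLinearMap) (TensorProduct.ext' fun x m => ?_) t
    change k at x
    have e : ∀ a b : H, M.leftUnit ((unit 𝓗).uact (M.deg.fst.1 a) x ⊗ₜ
        M.uact (M.deg.fst⁻¹.1 ((unit 𝓗).deg.snd.1 (M.deg.fst.1 b))) m) =
        𝓗.ε a • M.uact (𝓗.αAut.1 b) (M.μ (x • m)) := fun a b => by
      change M.μ ((𝓗.ε (M.deg.fst.1 a) • x) • M.uact (M.deg.fst⁻¹.1 (M.deg.fst.1 b)) m) = _
      rw [aut_inv_apply, smul_assoc, map_smul, map_smul, μ_uact hM, aut_counit, map_smul, map_smul]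
    rw [LinearMap.comp_apply, LinearMap.comp_apply, LinearEquiv.coe_coe, ha, uact_tensor_tmul,
      map_sw, sw_congr e, sw_counit_left (𝓗 := 𝓗.toMonoidalHomHopfAlgebra) _
        (f := fun b => M.uact (𝓗.αAut.1 b) (M.μ (x • m))) (by simp [smul_comm x]), aut_apply_inv]
  · refine LinearMap.congr_fun (f := M.ucoact ∘ₗ M.leftUnit.toLinearMap)
      (g := TensorProduct.map M.leftUnit.toLinearMap LinearMap.id ∘ₗ ((unit 𝓗).tensor M).ucoact)
      (TensorProduct.ext' fun x m => ?_) t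
    change k at x
    rw [LinearMap.comp_apply, LinearMap.comp_apply, LinearEquiv.coe_coe, ha,
      apply_eq_sw (TensorProduct.map _ _), ← sw_tmul_self (M.ucoact _), hM.untwist.sw_μ]
    refine Eq.trans ?_ (sw_ucoact_tensor_tmul (unit 𝓗) M _ _).symm
    change _ = sw (x ⊗ₜ[k] 𝓗.one) _
    rw [sw_tmul _ _ (by simp [-smul_eq_mul]), map_smul, sw_smul (by simp), ← sw_fun_smul]
    refine sw_congr fun y b => ?_
    rw [mul_one', TensorProduct.map_tmul, LinearEquiv.coe_coe, ha, map_smul, smul_tmul_eq]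
    rfl

theorem isHom_rightUnit {M : PreYD 𝓗} (hM : M.IsYD) :
    IsHom (M.tensor (unit 𝓗)) M M.rightUnit.toLinearMap := by
  have ha : ∀ (x : k) (m : M.V), M.rightUnit (m ⊗ₜ x) = M.μ (x • m) := fun _ _ => rfl
  refine isHom_of_untwisted (mul_one _) (fun t => ?_) (fun h t => ?_) (fun t => ?_)
  · refine LinearMap.congr_fun (f := M.rightUnit.toLinearMap ∘ₗ (M.tensor (unit 𝓗)).μ.toLinearMap)
      (g := M.μ.toLinearMap ∘ₗ M.rightUnit.toLinearMap) (TensorProduct.ext' fun m x => ?_) t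
    change M.rightUnit (M.μ m ⊗ₜ x) = M.μ (M.rightUnit (m ⊗ₜ x))
    rw [ha, ha, map_smul, map_smul, map_smul]
  · refine LinearMap.congr_fun (f := M.rightUnit.toLinearMap ∘ₗ (M.tensor (unit 𝓗)).uact h)
      (g := M.uact h ∘ₗ M.rightUnit.toLinearMap) (TensorProduct.ext' fun m x => ?_) t
    change k at x
    have e : ∀ a b : H, M.rightUnit (M.uact ((unit 𝓗).deg.fst.1 a) m ⊗ₜ
        (unit 𝓗).uact ((unit 𝓗).deg.fst⁻¹.1 (M.deg.snd.1 ((unit 𝓗).deg.fst.1 b))) x) =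
        𝓗.ε b • M.uact (𝓗.αAut.1 a) (M.μ (x • m)) := fun a b => by
      change M.μ ((𝓗.ε ((1 : AutMHH 𝓗.toMonoidalHomHopfAlgebra)⁻¹.1 (M.deg.snd.1 b)) • x) •
        M.uact a m) = _
      rw [aut_counit, smul_assoc, map_smul, map_smul, μ_uact hM, aut_counit, map_smul, map_smul]
    rw [LinearMap.comp_apply, LinearMap.comp_apply, LinearEquiv.coe_coe, ha, uact_tensor_tmul,
      map_sw, sw_congr e, sw_counit_right (𝓗 := 𝓗.toMonoidalHomHopfAlgebra) _
        (f := fun b => M.uact (𝓗.αAut.1 b) (M.μ (x • m))) (by simp [smul_comm x]), aut_apply_inv]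
  · refine LinearMap.congr_fun (f := M.ucoact ∘ₗ M.rightUnit.toLinearMap)
      (g := TensorProduct.map M.rightUnit.toLinearMap LinearMap.id ∘ₗ (M.tensor (unit 𝓗)).ucoact)
      (TensorProduct.ext' fun m x => ?_) t
    change k at x
    rw [LinearMap.comp_apply, LinearMap.comp_apply, LinearEquiv.coe_coe, ha,
      apply_eq_sw (TensorProduct.map _ _), ← sw_tmul_self (M.ucoact _), hM.untwist.sw_μ]
    refine Eq.trans ?_ (sw_ucoact_tensor_tmul M (unit 𝓗) _ _).symm
    rw [map_smul, sw_smul (by simp), ← sw_fun_smul]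
    refine sw_congr fun y b => ?_
    change _ = sw (x ⊗ₜ[k] 𝓗.one) _
    rw [sw_tmul _ _ (by simp [-smul_eq_mul]), one_mul', TensorProduct.map_tmul,
      LinearEquiv.coe_coe, ha, map_smul, smul_tmul_eq]
    rfl

/-! ### The braiding -/

theorem sw_ucoact_conj {X : Type*} [AddCommGroup X] [Module k X]
    (g : TwistedPair (AutMHH 𝓗.toMonoidalHomHopfAlgebra)) (N : PreYD 𝓗)
    (v : N.V) {f : N.V → H → X} (hf : IsBilin k f := by simp) :
    sw ((N.conj g).ucoact v) f =
      sw (N.ucoact v) fun x a => f x (g.fst.1 (g.snd⁻¹.1 a)) := by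
  rw [ucoact_conj, LinearMap.comp_apply, sw_map _ _ _ hf]
  rfl

theorem uact_conj_apply (g : TwistedPair (AutMHH 𝓗.toMonoidalHomHopfAlgebra)) (N : PreYD 𝓗)
    (h : H) (v : N.V) : (N.conj g).uact h v =
      N.uact (N.deg.fst⁻¹.1 (g.snd.1 (N.deg.fst.1 (g.fst⁻¹.1 h)))) v := rfl

/-- For `M` of index `(A, B)` and `N` of index `(C, D)`, the braiding is linear by the compatibility
of `N` at `C⁻¹BC(α⁻¹(h))`, and colinear by the compatibility of `M` at `B⁻¹(n₁)`. -/
theorem isHom_braid {M N : PreYD 𝓗} (hM : M.IsYD) (hN : N.IsYD) :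
    IsHom (M.tensor N) ((N.conj M.deg).tensor M) (braid M N) := by
  refine isHom_of_untwisted ?_ (fun t => ?_) (fun h t => ?_) (fun t => ?_)
  · change M.deg * N.deg = M.deg * N.deg * M.deg⁻¹ * M.deg
    group
  · refine LinearMap.congr_fun (f := braid M N ∘ₗ (M.tensor N).μ.toLinearMap)
      (g := ((N.conj M.deg).tensor M).μ.toLinearMap ∘ₗ braid M N)
      (TensorProduct.ext' fun m n => ?_) t
    change braid M N (M.μ m ⊗ₜ N.μ n) = TensorProduct.congr N.μ M.μ (braid M N (m ⊗ₜ n))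
    rw [braid_tmul hM hN, braid_tmul hM hN, map_sw, hN.untwist.sw_μ]
    refine sw_congr fun x a => ?_
    rw [TensorProduct.congr_tmul, μ_uact hM, αAut_apply, aut_α]
  · refine LinearMap.congr_fun (f := braid M N ∘ₗ (M.tensor N).uact h)
      (g := ((N.conj M.deg).tensor M).uact h ∘ₗ braid M N)
      (TensorProduct.ext' fun m n => ?_) t
    rw [LinearMap.comp_apply, LinearMap.comp_apply, uact_tensor_tmul, braid_tmul hM hN, map_sw,
      map_sw]
    -- Both sides involve the twist of `h` by `α⁻¹` in `uact_tensor`; it is hidden in a variable `g`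
    -- so that `sw_comul_aut` does not expand it.
    obtain ⟨g, hg⟩ : ∃ g, g = 𝓗.αAut⁻¹.1 h := ⟨_, rfl⟩
    rw [← hg]
    have hl : ∀ a b : H, braid M N (M.uact (N.deg.fst.1 a) m ⊗ₜ
        N.uact (N.deg.fst⁻¹.1 (M.deg.snd.1 (N.deg.fst.1 b))) n) =
        sw (N.ucoact (N.uact (N.deg.fst⁻¹.1 (M.deg.snd.1 (N.deg.fst.1 b))) n)) fun x c =>
          x ⊗ₜ[k] M.uact (M.deg.snd⁻¹.1 (𝓗.mul c (N.deg.fst.1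
            (N.deg.fst⁻¹.1 (M.deg.snd.1 (N.deg.fst.1 a)))))) m := fun a b => by
      rw [braid_tmul hM hN]
      refine sw_congr fun x c => ?_
      rw [aut_apply_inv, aut_mul, aut_inv_apply, hM.untwist.mul_act]
    have hr : ∀ (x : N.V) (c : H), ((N.conj M.deg).tensor M).uact h
        (x ⊗ₜ M.uact (M.deg.snd⁻¹.1 c) m) = sw (𝓗.comul g) fun a b =>
          N.uact (N.deg.fst⁻¹.1 (M.deg.snd.1 (N.deg.fst.1 a))) x ⊗ₜ[k]
            M.uact (M.deg.snd⁻¹.1 (𝓗.mul (N.deg.snd.1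
              (N.deg.fst⁻¹.1 (M.deg.snd.1 (N.deg.fst.1 b)))) c)) m := fun x c => by
      rw [hg]
      refine (uact_tensor_tmul (N.conj M.deg) M _ _ _).trans (sw_congr fun a b => ?_)
      rw [uact_conj_apply, aut_inv_apply, ← hM.untwist.mul_act]
      simp only [TwistedPair.snd_conj, aut_mul_apply, aut_inv_apply, aut_mul]
    have e := hN.untwist.sw_compat (N.deg.fst⁻¹.1 (M.deg.snd.1 (N.deg.fst.1 g))) n
      (f := fun x c => x ⊗ₜ[k] M.uact (M.deg.snd⁻¹.1 c) m)
    rw [sw_comul_aut, sw_comul_aut, sw_comul_aut, sw_comul_aut, sw_comul_aut, sw_comul_aut] at e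
    rw [sw_congr hl, sw_congr hr, sw_comm]
    exact e.symm
  · refine LinearMap.congr_fun (f := ((N.conj M.deg).tensor M).ucoact ∘ₗ braid M N)
      (g := TensorProduct.map (braid M N) LinearMap.id ∘ₗ (M.tensor N).ucoact)
      (TensorProduct.ext' fun m n => ?_) t
    rw [LinearMap.comp_apply, LinearMap.comp_apply, braid_tmul hM hN, map_sw,
      apply_eq_sw (TensorProduct.map _ _)]
    have hl : ∀ (x : N.V) (a : H), ((N.conj M.deg).tensor M).ucoact
        (x ⊗ₜ M.uact (M.deg.snd⁻¹.1 a) m) = sw (N.ucoact x) fun y b =>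
          sw (M.ucoact (M.uact (M.deg.snd⁻¹.1 a) m)) fun z c =>
            (y ⊗ₜ[k] z) ⊗ₜ[k] 𝓗.α (𝓗.mul c (M.deg.fst.1 (M.deg.snd⁻¹.1 b))) := fun x a => by
      rw [← sw_tmul_self (((N.conj M.deg).tensor M).ucoact _)]
      refine (sw_ucoact_tensor_tmul (N.conj M.deg) M _ _).trans ?_
      exact sw_ucoact_conj M.deg N x
    have hm : ∀ (x : N.V) (a : H), (sw (𝓗.comul a) fun b a' =>
          sw (M.ucoact (M.uact (M.deg.snd⁻¹.1 a') m)) fun z c =>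
            (x ⊗ₜ[k] z) ⊗ₜ[k] 𝓗.α (𝓗.mul c (M.deg.fst.1 (M.deg.snd⁻¹.1 b)))) =
        sw (𝓗.comul a) fun b a' => sw (M.ucoact m) fun z c =>
          (x ⊗ₜ[k] M.uact (M.deg.snd⁻¹.1 b) z) ⊗ₜ[k] 𝓗.α (𝓗.mul a' c) := fun x a => by
      have e := hM.untwist.sw_compat (M.deg.snd⁻¹.1 a) m
        (f := fun z c => (x ⊗ₜ[k] z) ⊗ₜ[k] 𝓗.α c)
      rw [sw_comul_aut, sw_comul_aut] at e
      simpa only [aut_apply_inv] using e.symm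
    have hr : (sw ((M.tensor N).ucoact (m ⊗ₜ n)) fun t a =>
        TensorProduct.map (braid M N) LinearMap.id (t ⊗ₜ a)) =
        sw (N.ucoact n) fun x a => sw (N.ucoact x) fun y b => sw (M.ucoact m) fun z c =>
          (y ⊗ₜ[k] M.uact (M.deg.snd⁻¹.1 b) z) ⊗ₜ[k] 𝓗.α (𝓗.mul a c) := by
      rw [sw_ucoact_tensor_tmul M N, sw_comm]
      refine sw_congr fun x a => ?_
      rw [sw_comm]
      refine sw_congr fun z c => ?_
      rw [TensorProduct.map_tmul, braid_tmul hM hN, sw_tmul_right]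
      rfl
    rw [sw_congr hl, hr]
    refine (hN.untwist.sw_coassoc n).trans (Eq.trans ?_ (hN.untwist.sw_coassoc n).symm)
    exact sw_congr hm

/-- The inverse `n ⊗ m ↦ B⁻¹(S(n₁)) · m ⊗ n₀` of the braiding, in terms of the untwisted
structure. -/
noncomputable def braidInv (M N : PreYD 𝓗) : ((N.conj M.deg).tensor M).V →ₗ[k] (M.tensor N).V :=
  (TensorProduct.comm k N.V M.V).toLinearMap ∘ₗ
    TensorProduct.map LinearMap.id
      (TensorProduct.lift (M.uact ∘ₗ (M.deg.snd⁻¹).1.toLinearMap ∘ₗ 𝓗.S)) ∘ₗ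
    (TensorProduct.assoc k N.V H M.V).toLinearMap ∘ₗ
    TensorProduct.map N.ucoact LinearMap.id

theorem braidInv_tmul (M N : PreYD 𝓗) (n : N.V) (m : M.V) : braidInv M N (n ⊗ₜ m) =
    sw (N.ucoact n) fun x a => M.uact (M.deg.snd⁻¹.1 (𝓗.S a)) m ⊗ₜ[k] x := by
  simp only [braidInv, LinearMap.comp_apply, TensorProduct.map_tmul]
  conv_lhs => rw [← sw_tmul_self (N.ucoact n)]
  rw [sw_tmul_right]
  simp only [map_sw]
  rfl

theorem braidInv_braid {M N : PreYD 𝓗} (hM : M.IsYD) (hN : N.IsYD) (t : (M.tensor N).V) :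
    braidInv M N (braid M N t) = t := by
  refine LinearMap.congr_fun (f := braidInv M N ∘ₗ braid M N) (g := LinearMap.id)
    (TensorProduct.ext' fun m n => ?_) t
  have h1 : ∀ x a, (sw (𝓗.comul a) fun b c =>
      M.uact (M.deg.snd⁻¹.1 (𝓗.S b)) (M.uact (M.deg.snd⁻¹.1 c) m) ⊗ₜ[k] x) =
      𝓗.ε a • (m ⊗ₜ[k] x : M.V ⊗[k] N.V) := fun x a => by
    have e := sw_antipode_left (𝓗 := 𝓗.toMonoidalHomHopfAlgebra) a
      (f := fun b => M.uact (M.deg.snd⁻¹.1 b) m ⊗ₜ[k] x)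
    simpa only [aut_mul, hM.untwist.mul_act, aut_one, hM.untwist.one_act] using e
  rw [LinearMap.comp_apply, braid_tmul hM hN, map_sw]
  refine (sw_congr fun x a => braidInv_tmul M N _ _).trans ?_
  rw [hN.untwist.sw_coassoc n (f := fun x b c =>
    M.uact (M.deg.snd⁻¹.1 (𝓗.S b)) (M.uact (M.deg.snd⁻¹.1 c) m) ⊗ₜ[k] x), sw_congr h1,
    hN.untwist.sw_counit n (f := fun x => (m ⊗ₜ[k] x : M.V ⊗[k] N.V))]
  rfl

theorem braid_braidInv {M N : PreYD 𝓗} (hM : M.IsYD) (hN : N.IsYD)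
    (t : ((N.conj M.deg).tensor M).V) : braid M N (braidInv M N t) = t := by
  refine LinearMap.congr_fun (f := braid M N ∘ₗ braidInv M N) (g := LinearMap.id)
    (TensorProduct.ext' fun n m => ?_) t
  have h1 : ∀ x a, (sw (𝓗.comul a) fun b c =>
      x ⊗ₜ[k] M.uact (M.deg.snd⁻¹.1 b) (M.uact (M.deg.snd⁻¹.1 (𝓗.S c)) m)) =
      𝓗.ε a • (x ⊗ₜ[k] m : N.V ⊗[k] M.V) := fun x a => by
    have e := sw_antipode_right (𝓗 := 𝓗.toMonoidalHomHopfAlgebra) a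
      (f := fun b => x ⊗ₜ[k] M.uact (M.deg.snd⁻¹.1 b) m)
    simpa only [aut_mul, hM.untwist.mul_act, aut_one, hM.untwist.one_act] using e
  rw [LinearMap.comp_apply, braidInv_tmul, map_sw]
  simp only [braid_tmul hM hN]
  rw [hN.untwist.sw_coassoc n (f := fun x b c =>
    x ⊗ₜ[k] M.uact (M.deg.snd⁻¹.1 b) (M.uact (M.deg.snd⁻¹.1 (𝓗.S c)) m)), sw_congr h1,
    hN.untwist.sw_counit n (f := fun x => (x ⊗ₜ[k] m : N.V ⊗[k] M.V))]
  rfl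

noncomputable def braidEquiv {M N : PreYD 𝓗} (hM : M.IsYD) (hN : N.IsYD) :
    (M.tensor N).V ≃ₗ[k] ((N.conj M.deg).tensor M).V :=
  LinearEquiv.ofLinearMap (braid M N) (braidInv M N) (LinearMap.ext (braid_braidInv hM hN))
    (LinearMap.ext (braidInv_braid hM hN))

end PreYD

theorem MHYD.closed (𝓗 : MonoidalHomHopfAlgebraBij k H) : MHYD.Closed 𝓗 where
  unit := PreYD.isYD_unit
  tensor M N := M.isYD.tensor N.isYD
  conj g N := N.isYD.conj g
  assoc M _ P := PreYD.isHom_assoc M.isYD P.isYD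
  leftUnit M := PreYD.isHom_leftUnit M.isYD
  rightUnit M := PreYD.isHom_rightUnit M.isYD
  braid M N := PreYD.isHom_braid M.isYD N.isYD

end Closed

/-! ### Strictness of the conjugation functors -/

section Category

variable {k H : Type u} [Field k] [AddCommGroup H] [Module k H]

open MonoidalHomHopfAlgebra

namespace PreYD

variable {𝓗 : MonoidalHomHopfAlgebraBij k H}

/-- Modules with the same space and automorphism are equal if their indices, actions and coactions
are. -/
theorem mk_congr {d d' : TwistedPair (AutMHH 𝓗.toMonoidalHomHopfAlgebra)} {V : Type u}
    [AddCommGroup V] [Module k V] {μ : V ≃ₗ[k] V} {a a' : H →ₗ[k] V →ₗ[k] V}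
    {ρ ρ' : V →ₗ[k] V ⊗[k] H} (hd : d = d') (ha : a = a') (hρ : ρ = ρ') :
    PreYD.mk (𝓗 := 𝓗) d V μ a ρ = PreYD.mk d' V μ a' ρ' := by
  subst hd ha hρ
  rfl

theorem conj_one (N : PreYD 𝓗) : N.conj 1 = N := by
  refine mk_congr (by group) ?_ ?_
  · have e : N.deg.fst⁻¹ * (1 : TwistedPair (AutMHH 𝓗.toMonoidalHomHopfAlgebra)).snd * N.deg.fst *
        (1 : TwistedPair (AutMHH 𝓗.toMonoidalHomHopfAlgebra)).fst⁻¹ = 1 := by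
      rw [TwistedPair.fst_one, TwistedPair.snd_one]; group
    rw [e]
    rfl
  · rw [TwistedPair.fst_one, TwistedPair.snd_one]
    have e : ((1 : AutMHH 𝓗.toMonoidalHomHopfAlgebra) * 1⁻¹).1.toLinearMap = LinearMap.id := by
      rw [inv_one, _root_.one_mul]; rfl
    rw [e, TensorProduct.map_id, LinearMap.id_comp]

theorem conj_mul (g h : TwistedPair (AutMHH 𝓗.toMonoidalHomHopfAlgebra)) (N : PreYD 𝓗) :
    N.conj (g * h) = (N.conj h).conj g := by
  refine mk_congr ?_ ?_ ?_
  · change g * h * N.deg * (g * h)⁻¹ = g * (h * N.deg * h⁻¹) * g⁻¹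
    group
  · have e : N.deg.fst⁻¹ * (g * h).snd * N.deg.fst * (g * h).fst⁻¹ =
        (N.deg.fst⁻¹ * h.snd * N.deg.fst * h.fst⁻¹) *
          ((h * N.deg * h⁻¹).fst⁻¹ * g.snd * (h * N.deg * h⁻¹).fst * g.fst⁻¹) := by
      simp only [TwistedPair.fst_mul, TwistedPair.snd_mul, TwistedPair.fst_inv]
      group
    rw [e]
    rfl
  · have e : (g * h).fst * (g * h).snd⁻¹ = (g.fst * g.snd⁻¹) * (h.fst * h.snd⁻¹) := by
      simp only [TwistedPair.fst_mul, TwistedPair.snd_mul]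
      group
    rw [e, ← LinearMap.comp_assoc, ← TensorProduct.map_comp]
    rfl

theorem conj_unit (g : TwistedPair (AutMHH 𝓗.toMonoidalHomHopfAlgebra)) :
    (unit 𝓗).conj g = unit 𝓗 := by
  refine mk_congr ?_ ?_ ?_
  · change g * 1 * g⁻¹ = 1
    group
  · refine LinearMap.ext fun h => LinearMap.ext fun x => ?_
    exact congrArg (· * x) (aut_counit _ h)
  · refine LinearMap.ext fun x => ?_
    change x ⊗ₜ[k] (g.fst * g.snd⁻¹).1 𝓗.one = x ⊗ₜ[k] 𝓗.one
    rw [aut_one]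

theorem conj_tensor (g : TwistedPair (AutMHH 𝓗.toMonoidalHomHopfAlgebra)) (M N : PreYD 𝓗) :
    (M.tensor N).conj g = (M.conj g).tensor (N.conj g) := by
  refine mk_congr ?_ ?_ ?_
  · change g * (M.deg * N.deg) * g⁻¹ = g * M.deg * g⁻¹ * (g * N.deg * g⁻¹)
    group
  · refine LinearMap.ext fun h => TensorProduct.ext' fun m n => ?_
    refine (tensorAct_tmul _ _ _ _ _ _).trans (Eq.trans ?_ (tensorAct_tmul _ _ _ _ _ _).symm)
    refine (sw_Δ_aut _ _).trans (sw_congr fun a b => ?_)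
    have h1 : N.deg.fst * ((M.deg * N.deg).fst⁻¹ * g.snd * (M.deg * N.deg).fst * g.fst⁻¹) =
        (M.deg.fst⁻¹ * g.snd * M.deg.fst * g.fst⁻¹) * (g * N.deg * g⁻¹).fst := by
      simp only [TwistedPair.fst_mul, TwistedPair.fst_inv]
      group
    have h2 : (N.deg.fst⁻¹ * M.deg.snd * N.deg.fst) *
        ((M.deg * N.deg).fst⁻¹ * g.snd * (M.deg * N.deg).fst * g.fst⁻¹) =
        (N.deg.fst⁻¹ * g.snd * N.deg.fst * g.fst⁻¹) *
          ((g * N.deg * g⁻¹).fst⁻¹ * (g * M.deg * g⁻¹).snd * (g * N.deg * g⁻¹).fst) := by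
      simp only [TwistedPair.fst_mul, TwistedPair.fst_inv, TwistedPair.snd_conj]
      group
    have e1 := congrArg (fun A : AutMHH 𝓗.toMonoidalHomHopfAlgebra => A.1 a) h1
    have e2 := congrArg (fun A : AutMHH 𝓗.toMonoidalHomHopfAlgebra => A.1 b) h2
    exact congrArg₂ (fun a b => M.act a m ⊗ₜ[k] N.act b n) e1 e2
  · refine TensorProduct.ext' fun m n => ?_
    refine Eq.trans ?_ (tensorCoact_tmul 𝓗.m (M.conj g).ρ (N.conj g).ρ m n).symm
    change TensorProduct.map LinearMap.id _ (tensorCoact 𝓗.m M.ρ N.ρ (m ⊗ₜ n)) = _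
    have h1 : ∀ (x : M.V) (a : H), (sw ((N.conj g).ρ n) fun y b => (x ⊗ₜ[k] y) ⊗ₜ[k] 𝓗.m b a) =
        sw (N.ρ n) fun y b => (x ⊗ₜ[k] y) ⊗ₜ[k] 𝓗.m ((g.fst * g.snd⁻¹).1 b) a := fun x a => by
      change sw (TensorProduct.map _ _ _) _ = _
      rw [sw_map]; rfl
    rw [sw_congr h1]
    change _ = sw (TensorProduct.map _ _ _) _
    rw [sw_map, tensorCoact_tmul, map_sw]
    refine sw_congr fun x a => ?_
    rw [map_sw]
    refine sw_congr fun y b => ?_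
    rw [TensorProduct.map_tmul, LinearEquiv.coe_coe, aut_m]
    rfl

/-! ### Identities of the braiding -/

theorem ucoact_map {M N : PreYD 𝓗} {f : M.V →ₗ[k] N.V} (hf : IsHom M N f) (v : M.V) :
    N.ucoact (f v) = TensorProduct.map f LinearMap.id (M.ucoact v) := by
  change N.ρ (N.μ (f v)) = TensorProduct.map f LinearMap.id (M.ρ (M.μ v))
  rw [← hf.map_μ, hf.map_ρ]

theorem uact_map {M N : PreYD 𝓗} {f : M.V →ₗ[k] N.V} (hf : IsHom M N f) (h : H) (v : M.V) :
    f (M.uact h v) = N.uact h (f v) := by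
  apply N.μ.injective
  rw [← hf.map_μ, ← act_eq, ← act_eq, hf.map_act]

theorem IsHom.map_μ_symm {M N : PreYD 𝓗} {f : M.V →ₗ[k] N.V} (hf : IsHom M N f) (v : M.V) :
    f (M.μ.symm v) = N.μ.symm (f v) := by
  rw [LinearEquiv.eq_symm_apply, ← hf.map_μ, LinearEquiv.apply_symm_apply]

theorem braid_natural {M M' N N' : PreYD 𝓗} (hM : M.IsYD) (hM' : M'.IsYD)
    (hN : N.IsYD) (hN' : N'.IsYD) {f : M.V →ₗ[k] M'.V} {g : N.V →ₗ[k] N'.V} (hf : IsHom M M' f)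
    (hg : IsHom N N' g) (m : M.V) (n : N.V) :
    braid M' N' (f m ⊗ₜ g n) = TensorProduct.map g f (braid M N (m ⊗ₜ n)) := by
  rw [braid_tmul hM hN, braid_tmul hM' hN', ucoact_map hg, sw_map, map_sw]
  refine sw_congr fun x a => ?_
  rw [TensorProduct.map_tmul, uact_map hf, hf.deg_eq]
  rfl

/-- The braiding does not change under conjugation: the automorphisms in the action of `M` and
the coaction of `N` cancel. -/
theorem braid_conj {M N : PreYD 𝓗} (hM : M.IsYD) (hN : N.IsYD)
    (g : TwistedPair (AutMHH 𝓗.toMonoidalHomHopfAlgebra)) (m : M.V) (n : N.V) :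
    braid (M.conj g) (N.conj g) (m ⊗ₜ n) = braid M N (m ⊗ₜ n) := by
  rw [braid_tmul hM hN]
  refine (braid_tmul (hM.conj g) (hN.conj g) m n).trans ?_
  refine (sw_ucoact_conj g N n).trans (sw_congr fun x a => ?_)
  have h : (M.deg.fst⁻¹ * g.snd * M.deg.fst * g.fst⁻¹) * ((g * M.deg * g⁻¹).snd⁻¹ *
      (g.fst * g.snd⁻¹)) = M.deg.snd⁻¹ := by
    rw [TwistedPair.snd_conj]
    group
  rw [← h]
  rfl

/-- The hexagon identity for a tensor product on the left, which is coassociativity of `P`. -/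
theorem braid_tensor_left {M N P : PreYD 𝓗} (hM : M.IsYD) (hN : N.IsYD) (hP : P.IsYD)
    (m : M.V) (n : N.V) (p : P.V) :
    braid (M.tensor N) P ((m ⊗ₜ n) ⊗ₜ p) =
      assoc ((P.conj N.deg).conj M.deg) M N
        (TensorProduct.map (braid M (P.conj N.deg)) LinearMap.id
          ((assoc M (P.conj N.deg) N).symm
            (TensorProduct.map LinearMap.id (braid N P) (assoc M N P ((m ⊗ₜ n) ⊗ₜ p))))) := by
  have h1 : assoc M N P ((m ⊗ₜ n) ⊗ₜ p) = M.μ m ⊗ₜ (n ⊗ₜ P.μ.symm p) := rfl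
  have h2 : ∀ (x : P.V) (y : N.V), (assoc M (P.conj N.deg) N).symm (M.μ m ⊗ₜ (x ⊗ₜ y)) =
      (m ⊗ₜ x) ⊗ₜ N.μ y := fun x y => by
    rw [LinearEquiv.symm_apply_eq]
    change _ = M.μ m ⊗ₜ (x ⊗ₜ N.μ.symm (N.μ y))
    rw [LinearEquiv.symm_apply_apply]
  have h3 : ∀ (x : P.V) (y : M.V) (z : N.V), assoc ((P.conj N.deg).conj M.deg) M N
      ((x ⊗ₜ y) ⊗ₜ z) = P.μ x ⊗ₜ (y ⊗ₜ N.μ.symm z) := fun _ _ _ => rfl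
  have hl : ∀ (x : P.V) (a : H), x ⊗ₜ[k] (M.tensor N).uact ((M.tensor N).deg.snd⁻¹.1 a) (m ⊗ₜ n) =
      sw (𝓗.comul a) fun b c => x ⊗ₜ[k]
        (M.uact (M.deg.snd⁻¹.1 (N.deg.fst.1 (N.deg.snd⁻¹.1 (𝓗.α.symm b)))) m ⊗ₜ[k]
          N.uact (N.deg.snd⁻¹.1 (𝓗.α.symm c)) n) := fun x a => by
    rw [uact_tensor_tmul, sw_comul_aut, sw_comul_aut, sw_tmul_left]
    refine sw_congr fun b c => ?_
    simp only [TwistedPair.snd_mul, mul_inv_rev, inv_inv, aut_mul_apply, aut_apply_inv,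
      aut_inv_apply, αAut_inv_apply, aut_α_symm]
  have hr : ∀ (x : P.V) (a : H), assoc ((P.conj N.deg).conj M.deg) M N
        (TensorProduct.map (braid M (P.conj N.deg)) LinearMap.id
          ((assoc M (P.conj N.deg) N).symm
            (M.μ m ⊗ₜ (P.μ.symm x ⊗ₜ N.uact (N.deg.snd⁻¹.1 (𝓗.α.symm a)) n)))) =
      sw (P.ucoact x) fun y b => y ⊗ₜ[k]
        (M.uact (M.deg.snd⁻¹.1 (N.deg.fst.1 (N.deg.snd⁻¹.1 (𝓗.α.symm b)))) m ⊗ₜ[k]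
          N.uact (N.deg.snd⁻¹.1 (𝓗.α.symm a)) n) := fun x a => by
    rw [h2, TensorProduct.map_tmul, braid_tmul hM (hP.conj N.deg), sw_tmul_right, map_sw]
    refine (sw_ucoact_conj N.deg P _).trans ?_
    rw [sw_ucoact_μ_symm hP]
    refine sw_congr fun y b => ?_
    rw [h3, LinearMap.id_apply, LinearEquiv.symm_apply_apply, LinearEquiv.apply_symm_apply]
  rw [h1, TensorProduct.map_tmul, LinearMap.id_apply, braid_tmul hN hP, sw_tmul_left, map_sw,
    map_sw, map_sw, sw_ucoact_μ_symm hP, sw_congr hr, braid_tmul (hM.tensor hN) hP, sw_congr hl]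
  exact (hP.untwist.sw_coassoc p).symm

/-- The hexagon identity for a tensor product on the right, which is associativity of the action
on `M`. -/
theorem braid_tensor_right {M N P : PreYD 𝓗} (hM : M.IsYD) (hN : N.IsYD) (hP : P.IsYD)
    (m : M.V) (n : N.V) (p : P.V) :
    braid M (N.tensor P) (m ⊗ₜ (n ⊗ₜ p)) =
      (assoc (N.conj M.deg) (P.conj M.deg) M).symm
        (TensorProduct.map LinearMap.id (braid M P)
          (assoc (N.conj M.deg) M P
            (TensorProduct.map (braid M N) LinearMap.id ((assoc M N P).symm
              (m ⊗ₜ (n ⊗ₜ p)))))) := by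
  have h1 : (assoc M N P).symm (m ⊗ₜ (n ⊗ₜ p)) = (M.μ.symm m ⊗ₜ n) ⊗ₜ P.μ p := by
    rw [LinearEquiv.symm_apply_eq]
    change _ = M.μ (M.μ.symm m) ⊗ₜ (n ⊗ₜ P.μ.symm (P.μ p))
    rw [LinearEquiv.symm_apply_apply, LinearEquiv.apply_symm_apply]
  have h2 : ∀ (x : N.V) (y : M.V), assoc (N.conj M.deg) M P ((x ⊗ₜ y) ⊗ₜ P.μ p) =
      N.μ x ⊗ₜ (y ⊗ₜ p) := fun x y => by
    change N.μ x ⊗ₜ (y ⊗ₜ P.μ.symm (P.μ p)) = _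
    rw [LinearEquiv.symm_apply_apply]
  have h3 : ∀ (x : N.V) (y : P.V) (z : M.V), (assoc (N.conj M.deg) (P.conj M.deg) M).symm
      (N.μ x ⊗ₜ (y ⊗ₜ z)) = (x ⊗ₜ y) ⊗ₜ M.μ z := fun x y z => by
    rw [LinearEquiv.symm_apply_eq]
    change _ = N.μ x ⊗ₜ (y ⊗ₜ M.μ.symm (M.μ z))
    rw [LinearEquiv.symm_apply_apply]
  rw [braid_tmul hM (hN.tensor hP), h1, TensorProduct.map_tmul, braid_tmul hM hN, sw_tmul_right,
    map_sw, map_sw, map_sw, sw_ucoact_tensor_tmul N P]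
  refine sw_congr fun x a => ?_
  rw [LinearMap.id_apply, h2, TensorProduct.map_tmul, braid_tmul hM hP, sw_tmul_left, map_sw]
  refine sw_congr fun y b => ?_
  rw [LinearMap.id_apply, h3, ← hM.untwist.mul_act, ← aut_mul, μ_uact hM, αAut_apply, aut_α,
    LinearEquiv.apply_symm_apply]

end PreYD

/-! ### The braided category -/

namespace MHYD

variable {𝓗 : MonoidalHomHopfAlgebraBij k H}

theorem comp_lin {M N P : MHYD 𝓗} (f : M ⟶ N) (g : N ⟶ P) : (f ≫ g).lin = g.lin ∘ₗ f.lin := rfl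

theorem hom_ext {M N : MHYD 𝓗} {f g : M ⟶ N} (h : f.lin = g.lin) : f = g := Hom.ext h

/-- The identification of equal objects is a cast of vectors. It is definitionally the identity if
the underlying spaces agree definitionally, as they do in all uses below. -/
theorem eqToHom_lin_apply {M N : MHYD 𝓗} (h : M = N) (v : M.pre.V) :
    (eqToHom h).lin v = cast (congrArg (fun M => M.pre.V) h) v := by
  subst h
  rfl

theorem eq_of_pre {M N : MHYD 𝓗} (h : M.pre = N.pre) : M = N := by
  cases M; cases N; cases h; rfl

/-- The tensor product, unit and constraints form a monoidal category. -/
@[reducible]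
noncomputable def monoidalCategory (h : Closed 𝓗) : MonoidalCategory (MHYD 𝓗) :=
  letI := monoidalStruct h
  { monoidalStruct h with
    tensorHom_def := fun f g => hom_ext (TensorProduct.ext' fun _ _ => rfl)
    id_tensorHom_id := fun M N => hom_ext (TensorProduct.ext' fun _ _ => rfl)
    tensorHom_comp_tensorHom := fun _ _ _ _ => hom_ext (TensorProduct.ext' fun _ _ => rfl)
    whiskerLeft_id := fun M N => hom_ext (TensorProduct.ext' fun _ _ => rfl)
    id_whiskerRight := fun M N => hom_ext (TensorProduct.ext' fun _ _ => rfl)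
    associator_naturality := fun f g h' => hom_ext (TensorProduct.ext_threefold fun m n p =>
      congrArg₂ (fun x y => x ⊗ₜ (g.lin n ⊗ₜ y)) (f.isHom.map_μ m).symm
        (h'.isHom.map_μ_symm p).symm)
    leftUnitor_naturality := fun {M N} f => hom_ext (TensorProduct.ext' fun x m => by
      change N.pre.μ (x • f.lin m) = f.lin (M.pre.μ (x • m))
      rw [f.isHom.map_μ, map_smul, map_smul, map_smul])
    rightUnitor_naturality := fun {M N} f => hom_ext (TensorProduct.ext' fun m x => by
      change N.pre.μ (x • f.lin m) = f.lin (M.pre.μ (x • m))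
      rw [f.isHom.map_μ, map_smul, map_smul, map_smul])
    pentagon := fun M N P Q => hom_ext (TensorProduct.ext_fourfold fun _ _ _ _ => rfl)
    triangle := fun M N => hom_ext (TensorProduct.ext_threefold fun m x n => by
      change M.pre.μ m ⊗ₜ[k] N.pre.μ (x • N.pre.μ.symm n) = M.pre.μ (x • m) ⊗ₜ[k] n
      rw [map_smul, map_smul, LinearEquiv.apply_symm_apply, TensorProduct.smul_tmul]) }

theorem isCrossedCategory (h : MHYD.Closed 𝓗) :
    let _ : MonoidalCategoryStruct (MHYD 𝓗) := MHYD.monoidalStruct h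
    IsCrossedCategory (C := MHYD 𝓗) MHYD.deg (MHYD.conj h) := by
  intro _
  refine
  { monoidal := ⟨MHYD.monoidalCategory h, rfl⟩
    deg_hom := fun f => f.isHom.deg_eq
    deg_tensor := fun X Y => rfl
    conj_one := ?_
    conj_mul := fun g g' => ?_
    conj_strict := fun g => ?_
    deg_conj := fun g X => rfl }
  · refine CategoryTheory.Functor.ext (fun N => eq_of_pre N.pre.conj_one) fun M N f => ?_
    refine hom_ext (LinearMap.ext fun v => ?_)
    rw [comp_lin, comp_lin, LinearMap.comp_apply, LinearMap.comp_apply, eqToHom_lin_apply,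
      eqToHom_lin_apply]
    rfl
  · refine CategoryTheory.Functor.ext (fun N => eq_of_pre (PreYD.conj_mul g g' N.pre))
      fun M N f => ?_
    refine hom_ext (LinearMap.ext fun v => ?_)
    rw [comp_lin, comp_lin, LinearMap.comp_apply, LinearMap.comp_apply, eqToHom_lin_apply,
      eqToHom_lin_apply]
    rfl
  · refine
    { obj_unit := eq_of_pre (PreYD.conj_unit g)
      obj_tensor := fun X Y => eq_of_pre (PreYD.conj_tensor g X.pre Y.pre)
      map_tensor := fun f f' => ?_
      map_associator := fun X Y Z => ?_
      map_leftUnitor := fun X => ?_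
      map_rightUnitor := fun X => ?_ }
    · refine hom_ext (LinearMap.ext fun v => ?_)
      rw [comp_lin, comp_lin, LinearMap.comp_apply, LinearMap.comp_apply, eqToHom_lin_apply,
        eqToHom_lin_apply]
      rfl
    · refine hom_ext (LinearMap.ext fun v => ?_)
      rw [comp_lin, comp_lin, LinearMap.comp_apply, LinearMap.comp_apply, eqToHom_lin_apply,
        eqToHom_lin_apply]
      rfl
    · refine hom_ext (LinearMap.ext fun v => ?_)
      rw [comp_lin, LinearMap.comp_apply, eqToHom_lin_apply]
      rfl
    · refine hom_ext (LinearMap.ext fun v => ?_)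
      rw [comp_lin, LinearMap.comp_apply, eqToHom_lin_apply]
      rfl

/-- An `eqToHom` at the end of a composite can be dropped at the price of a heterogeneous equality
of vectors. -/
theorem eq_comp_eqToHom {M N P Q R S T : MHYD 𝓗} {f : M ⟶ T} {f₁ : M ⟶ N} {f₂ : N ⟶ P}
    {f₃ : P ⟶ Q} {f₄ : Q ⟶ R} {f₅ : R ⟶ S} (h : S = T)
    (H : ∀ v, f.lin v ≍ f₅.lin (f₄.lin (f₃.lin (f₂.lin (f₁.lin v))))) :
    f = f₁ ≫ f₂ ≫ f₃ ≫ f₄ ≫ f₅ ≫ eqToHom h := by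
  subst h
  exact hom_ext (LinearMap.ext fun v => eq_of_heq (H v))

theorem braiding_tensor_left (h : Closed 𝓗) (U V W : MHYD 𝓗)
    (v : (U.pre.V ⊗[k] V.pre.V) ⊗[k] W.pre.V) :
    letI : MonoidalCategoryStruct (MHYD 𝓗) := MHYD.monoidalStruct h
    (braiding h (U ⊗ V) W).lin v =
      (α_ ((conj h (deg U)).obj ((conj h (deg V)).obj W)) U V).hom.lin
        ((braiding h U ((conj h (deg V)).obj W) ⊗ₘ 𝟙 V).lin
          ((α_ U ((conj h (deg V)).obj W) V).inv.lin
            ((𝟙 U ⊗ₘ braiding h V W).lin ((α_ U V W).hom.lin v)))) :=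
  LinearMap.congr_fun (f := PreYD.braid (U.pre.tensor V.pre) W.pre)
    (g := (PreYD.assoc ((W.pre.conj V.deg).conj U.deg) U.pre V.pre).toLinearMap ∘ₗ
      TensorProduct.map (PreYD.braid U.pre (W.pre.conj V.deg)) LinearMap.id ∘ₗ
        (PreYD.assoc U.pre (W.pre.conj V.deg) V.pre).symm.toLinearMap ∘ₗ
          TensorProduct.map LinearMap.id (PreYD.braid V.pre W.pre) ∘ₗ
            (PreYD.assoc U.pre V.pre W.pre).toLinearMap)
    (TensorProduct.ext_threefold (PreYD.braid_tensor_left U.isYD V.isYD W.isYD)) v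

theorem braiding_tensor_right (h : Closed 𝓗) (U V W : MHYD 𝓗)
    (v : U.pre.V ⊗[k] (V.pre.V ⊗[k] W.pre.V)) :
    letI : MonoidalCategoryStruct (MHYD 𝓗) := MHYD.monoidalStruct h
    (braiding h U (V ⊗ W)).lin v =
      (α_ ((conj h (deg U)).obj V) ((conj h (deg U)).obj W) U).inv.lin
        ((𝟙 ((conj h (deg U)).obj V) ⊗ₘ braiding h U W).lin
          ((α_ ((conj h (deg U)).obj V) U W).hom.lin
            ((braiding h U V ⊗ₘ 𝟙 W).lin ((α_ U V W).inv.lin v)))) :=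
  LinearMap.congr_fun (f := PreYD.braid U.pre (V.pre.tensor W.pre))
    (g := (PreYD.assoc (V.pre.conj U.deg) (W.pre.conj U.deg) U.pre).symm.toLinearMap ∘ₗ
      TensorProduct.map LinearMap.id (PreYD.braid U.pre W.pre) ∘ₗ
        (PreYD.assoc (V.pre.conj U.deg) U.pre W.pre).toLinearMap ∘ₗ
          TensorProduct.map (PreYD.braid U.pre V.pre) LinearMap.id ∘ₗ
            (PreYD.assoc U.pre V.pre W.pre).symm.toLinearMap)
    (TensorProduct.ext_threefold' (PreYD.braid_tensor_right U.isYD V.isYD W.isYD)) v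

end MHYD

end Category

theorem theorem3p7 {k H : Type u} [Field k] [AddCommGroup H] [Module k H]
    (𝓗 : MonoidalHomHopfAlgebraBij k H) :
    ∃ h : MHYD.Closed 𝓗,
      letI : MonoidalCategoryStruct (MHYD 𝓗) := MHYD.monoidalStruct h
      IsBraidedTCategory (C := MHYD 𝓗) MHYD.deg (MHYD.conj h) (MHYD.braiding h) := by
  refine ⟨MHYD.closed 𝓗, ?_⟩
  let _ : MonoidalCategoryStruct (MHYD 𝓗) := MHYD.monoidalStruct (MHYD.closed 𝓗)
  refine
  { crossed := MHYD.isCrossedCategory _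
    isIso := fun U V => ?_
    naturality := fun {U U' V V'} f g => ?_
    tensor_left := fun U V W => ?_
    tensor_right := fun U V W => ?_
    conj_braiding := fun g U V => ?_ }
  · exact (MHYD.isoMk (M := ⟨U.pre.tensor V.pre, U.isYD.tensor V.isYD⟩)
      (N := ⟨(V.pre.conj U.pre.deg).tensor U.pre, (V.isYD.conj _).tensor U.isYD⟩)
      (PreYD.braidEquiv U.isYD V.isYD) (PreYD.isHom_braid U.isYD V.isYD)).isIso_hom
  · refine MHYD.hom_ext (TensorProduct.ext' fun m n => ?_)
    refine (PreYD.braid_natural (U.isYD) U'.isYD V.isYD V'.isYD f.isHom g.isHom m n).trans ?_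
    have e : ((MHYD.conj (MHYD.closed 𝓗) U.deg).map g ≫
        eqToHom (by rw [MHYD.deg, f.isHom.deg_eq]) :
          _ ⟶ (MHYD.conj (MHYD.closed 𝓗) U'.deg).obj V').lin = g.lin :=
      LinearMap.ext fun v => MHYD.eqToHom_lin_apply _ _
    exact congrArg (fun l : V.pre.V →ₗ[k] V'.pre.V =>
      TensorProduct.map l f.lin (PreYD.braid U.pre V.pre (m ⊗ₜ n))) e.symm
  · exact MHYD.eq_comp_eqToHom _ fun v =>
      heq_of_eq (MHYD.braiding_tensor_left _ U V W v)
  · exact MHYD.eq_comp_eqToHom _ fun v =>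
      heq_of_eq (MHYD.braiding_tensor_right _ U V W v)
  · refine MHYD.hom_ext (TensorProduct.ext' fun m n => ?_)
    refine (PreYD.braid_conj U.isYD V.isYD g m n).symm.trans ?_
    rw [MHYD.comp_lin, MHYD.comp_lin, LinearMap.comp_apply, LinearMap.comp_apply,
      MHYD.eqToHom_lin_apply, MHYD.eqToHom_lin_apply]
    exact (cast_eq rfl _).symm
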